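/- Setting. Fix a countably infinite universe $U$. A database schema $\tau$ is a finite nonempty set of relation symbols $R$ with arities $\mathrm{ar}(R)\in\mathbb N$. A $\tau$-fact is an expression $R(u_1,\dots,u_{\mathrm{ar}(R)})$ with $R\in\tau$ and $u_i\in U$, and a $\tau$-instance is a finite set $D$ of $\tau$-facts; its size $|D|$ is its number of facts. A probabilistic database (PDB) over $\tau$ is a discrete probability space $(\mathbb D,P)$ whose countable sample space $\mathbb D$ is a set of $\tau$-instances; $\mathrm{worlds}(\mathbb D,P)$ is the set of $D\in\mathbb D$ with $P(\{D\})>0$. A PDB $\mathcal I$ is tuple-independent (in $\mathsf{TI}$) if $\Pr_{I\sim\mathcal I}(f_1\in I,\dots,f_k\in I)=\prod_{i=1}^k\Pr_{I\sim\mathcal I}(f_i\in I)$ for all $k$ and all pairwise distinct facts $f_1,\dots,f_k$ that appear in possible worlds of $\mathcal I$. A first-order view from a schema $\sigma$ to $\tau$ consists of one first-order formula $\Phi_R(x_1,\dots,x_{\mathrm{ar}(R)})$ over $\sigma$ (with equality, and constants from $U$) for each $R\in\tau$, evaluated under the active domain semantics (quantified variables and answer tuples range over the elements of $U$ that occur in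 the input instance or as constants in $\Phi_R$); it maps a $\sigma$-instance to a $\tau$-instance, and a PDB over $\sigma$ to its image PDB over $\tau$, where $P'(\{D'\})=P(\{D : V(D)=D'\})$. $\mathsf{FO}(\mathsf{TI})$ is the class of all PDBs that are images of tuple-independent PDBs (over any schema and the same universe $U$) under first-order views. Theorem. Let $\mathbb D$ be a set of database instances over the same schema $\tau$. 1. If $\mathbb D$ has bounded instance size, i.e. there is $c\in\mathbb N$ with $|D|\le c$ for all $D\in\mathbb D$, then $\mathcal D\in\mathsf{FO}(\mathsf{TI})$ for every PDB $\mathcal D$ over $\tau$ with $\mathrm{worlds}(\mathcal D)=\mathbb D$. 2. If $\mathbb D$ has unbounded instance size, i.e. for all $n\in\mathbb N$ there is $D\in\mathbb D$ with $|D|\ge n$, then there exist PDBs $\mathcal D_1\in\mathsf{FO}(\mathsf{TI})$ and $\mathcal D_2\notin\mathsf{FO}(\mathsf{TI})$ over $\tau$ such that $\mathrm{worlds}(\mathcal D_1)=\mathrm{worlds}(\mathcal D_2)=\mathbb D$. In particular, there are no purely logical reasons for non-membership in $\mathsf{FO}(\mathsf{TI})$: for every nonempty set $\mathbb D$ of $\tau$-instances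 there is a PDB $\mathcal D\in\mathsf{FO}(\mathsf{TI})$ with $\mathrm{worlds}(\mathcal D)=\mathbb D$. -/

import Mathlib

namespace ProbDB

/-- A database schema: a finite, nonempty set of relation symbols with arities. -/
structure Schema where
  /-- the relation symbols -/
  Rel : Type
  /-- the arity of a relation symbol -/
  ar : Rel → ℕ
  finite_rel : Finite Rel
  nonempty_rel : Nonempty Rel

attribute [instance] Schema.finite_rel Schema.nonempty_rel

universe u

/-- A fact `R(u₁, …, u_{ar R})` over the schema `τ` with entries in the universe `U`. -/
abbrev Fact (τ : Schema) (U : Type u) : Type u :=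
  Σ R : τ.Rel, (Fin (τ.ar R) → U)

/-- A database instance is a finite set of facts; its size is `Finset.card`. -/
abbrev Inst (τ : Schema) (U : Type u) : Type u :=
  Finset (Fact τ U)

/-- The active domain of an instance: the elements of `U` appearing among its facts. -/
def adom {τ : Schema} {U : Type u} (D : Inst τ U) : Set U :=
  {a | ∃ f ∈ D, ∃ i, f.2 i = a}

/-! ### First-order formulas with active domain semantics -/

/-- A term is one of the `n` variables in scope or a constant from `U`. -/
inductive FOTerm (U : Type u) (n : ℕ) : Type u
  | var (i : Fin n) : FOTerm U n
  | const (a : U) : FOTerm U n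

/-- First-order formulas over `τ` with constants from `U`, whose free variables are among
`x₀, …, x_{n-1}`. A quantifier binds the last variable `x_n` of a formula in `n + 1` variables. -/
inductive Formula (τ : Schema) (U : Type u) : ℕ → Type u
  | rel {n : ℕ} (R : τ.Rel) (t : Fin (τ.ar R) → FOTerm U n) : Formula τ U n
  | eq {n : ℕ} (i : Fin n) (t : FOTerm U n) : Formula τ U n
  | not {n : ℕ} (φ : Formula τ U n) : Formula τ U n
  | and {n : ℕ} (φ ψ : Formula τ U n) : Formula τ U n
  | or {n : ℕ} (φ ψ : Formula τ U n) : Formula τ U n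
  | ex {n : ℕ} (φ : Formula τ U (n + 1)) : Formula τ U n
  | all {n : ℕ} (φ : Formula τ U (n + 1)) : Formula τ U n

/-- The constants appearing in a term. -/
def FOTerm.consts {U : Type u} {n : ℕ} : FOTerm U n → Set U
  | .var _ => ∅
  | .const a => {a}

/-- The value of a term under a valuation of the variables. -/
def FOTerm.val {U : Type u} {n : ℕ} (v : Fin n → U) : FOTerm U n → U
  | .var i => v i
  | .const a => a

/-- The constants appearing in a formula, `adom(Φ)`. -/
def Formula.consts {τ : Schema} {U : Type u} : {n : ℕ} → Formula τ U n → Set U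
  | _, .rel _ t => ⋃ i, (t i).consts
  | _, .eq _ t => t.consts
  | _, .not φ => φ.consts
  | _, .and φ ψ => φ.consts ∪ ψ.consts
  | _, .or φ ψ => φ.consts ∪ ψ.consts
  | _, .ex φ => φ.consts
  | _, .all φ => φ.consts

/-- Satisfaction in the instance `D` under the valuation `v`, where all quantifiers range
over the set `A`. -/
def Formula.SatIn {τ : Schema} {U : Type u} (D : Inst τ U) (A : Set U) :
    {n : ℕ} → Formula τ U n → (Fin n → U) → Prop
  | _, .rel R t, v => (⟨R, fun i => (t i).val v⟩ : Fact τ U) ∈ D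
  | _, .eq i t, v => v i = t.val v
  | _, .not φ, v => ¬ φ.SatIn D A v
  | _, .and φ ψ, v => φ.SatIn D A v ∧ ψ.SatIn D A v
  | _, .or φ ψ, v => φ.SatIn D A v ∨ ψ.SatIn D A v
  | _, .ex φ, v => ∃ a ∈ A, φ.SatIn D A (Fin.snoc v a : Fin (_ + 1) → U)
  | _, .all φ, v => ∀ a ∈ A, φ.SatIn D A (Fin.snoc v a : Fin (_ + 1) → U)

/-- `adom(D, Φ)`: the active domain of `D` together with the constants appearing in `Φ`. -/
def Formula.adom {τ : Schema} {U : Type u} {n : ℕ} (Φ : Formula τ U n) (D : Inst τ U) : Set U :=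
  ProbDB.adom D ∪ Φ.consts

/-- The set of answer tuples of `Φ(x₀, …, x_{n-1})` on `D` under the active domain semantics:
both the quantifiers and the entries of the answers range over `adom(D, Φ)`. -/
def Formula.answers {τ : Schema} {U : Type u} {n : ℕ} (Φ : Formula τ U n) (D : Inst τ U) :
    Set (Fin n → U) :=
  {a | (∀ i, a i ∈ Φ.adom D) ∧ Φ.SatIn D (Φ.adom D) a}

theorem adom_finite {τ : Schema} {U : Type u} (D : Inst τ U) : (adom D).Finite := by
  have h : adom D = ⋃ f ∈ (D : Set (Fact τ U)), Set.range f.2 := by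
    ext a
    simp only [adom, Set.mem_ofPred_eq, Set.mem_iUnion, Set.mem_range, exists_prop,
      SetLike.mem_coe]
  rw [h]
  exact D.finite_toSet.biUnion fun f _ => Set.finite_range f.2

theorem FOTerm.consts_finite {U : Type u} {n : ℕ} (t : FOTerm U n) : t.consts.Finite := by
  cases t with
  | var i => exact Set.finite_empty
  | const a => exact Set.finite_singleton a

theorem Formula.consts_finite {τ : Schema} {U : Type u} {n : ℕ} (Φ : Formula τ U n) :
    Φ.consts.Finite := by
  induction Φ with
  | rel R t => exact Set.finite_iUnion fun i => (t i).consts_finite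
  | eq i t => exact t.consts_finite
  | not φ ih => exact ih
  | and φ ψ ih₁ ih₂ => exact ih₁.union ih₂
  | or φ ψ ih₁ ih₂ => exact ih₁.union ih₂
  | ex φ ih => exact ih
  | all φ ih => exact ih

theorem Formula.answers_finite {τ : Schema} {U : Type u} {n : ℕ} (Φ : Formula τ U n)
    (D : Inst τ U) : (Φ.answers D).Finite :=
  (Set.Finite.pi' fun _ => (adom_finite D).union Φ.consts_finite).subset fun _ ha => ha.1

/-- A first-order view from `σ` to `τ`: a formula over `σ` for each relation symbol of `τ`,
with one variable in scope for each argument position of that symbol. -/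
def FOView (σ τ : Schema) (U : Type u) : Type u :=
  (R : τ.Rel) → Formula σ U (τ.ar R)

theorem FOView.output_finite {σ τ : Schema} {U : Type u} (V : FOView σ τ U) (D : Inst σ U) :
    {f : Fact τ U | f.2 ∈ (V f.1).answers D}.Finite := by
  have h : {f : Fact τ U | f.2 ∈ (V f.1).answers D} =
      ⋃ R : τ.Rel, (fun a => (⟨R, a⟩ : Fact τ U)) '' (V R).answers D := by
    ext ⟨R, a⟩
    simp only [Set.mem_ofPred_eq, Set.mem_iUnion, Set.mem_image]
    constructor
    · intro ha
      exact ⟨R, a, ha, rfl⟩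
    · rintro ⟨R', a', ha, heq⟩
      cases heq
      exact ha
  rw [h]
  exact Set.finite_iUnion fun R => ((V R).answers_finite D).image _

/-- The image `V(D)` of an instance under a first-order view: the facts `R(a)` such that `a`
is an answer of the formula for `R` on `D`. -/
noncomputable def FOView.apply {σ τ : Schema} {U : Type u} (V : FOView σ τ U) (D : Inst σ U) :
    Inst τ U :=
  (V.output_finite D).toFinset

theorem FOView.mem_apply {σ τ : Schema} {U : Type u} (V : FOView σ τ U) (D : Inst σ U)
    (f : Fact τ U) : f ∈ V.apply D ↔ f.2 ∈ (V f.1).answers D := by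
  simp [FOView.apply]

/-! ### Probabilistic databases -/

/-- A probabilistic database: a countable set of instances (the sample space) with a probability
distribution on it. The distribution is stored as a probability mass function on all instances
that vanishes outside the sample space; in particular the sample space is nonempty. -/
structure PDB (τ : Schema) (U : Type u) where
  /-- the sample space -/
  space : Set (Inst τ U)
  countable_space : space.Countable
  /-- the probability of each instance -/
  prob : PMF (Inst τ U)
  support_subset : prob.support ⊆ space

/-- The possible worlds: the instances of positive probability. -/
def PDB.worlds {τ : Schema} {U : Type u} (𝓓 : PDB τ U) : Set (Inst τ U) :=
  {D | D ∈ 𝓓.space ∧ 0 < 𝓓.prob D}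

/-- The probability of an event. -/
noncomputable def PDB.Pr {τ : Schema} {U : Type u} (𝓓 : PDB τ U) (E : Set (Inst τ U)) :
    ENNReal :=
  𝓓.prob.toOuterMeasure E

/-- The facts appearing in some possible world. -/
def PDB.facts {τ : Schema} {U : Type u} (𝓓 : PDB τ U) : Set (Fact τ U) :=
  {f | ∃ D ∈ 𝓓.worlds, f ∈ D}

/-- The class `TI` of tuple-independent PDBs: any finitely many pairwise distinct facts in
`facts(𝓘)` satisfy `Pr(f₁ ∈ I, …, f_k ∈ I) = ∏ᵢ Pr(fᵢ ∈ I)`. -/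
def PDB.IsTI {τ : Schema} {U : Type u} (𝓘 : PDB τ U) : Prop :=
  ∀ S : Finset (Fact τ U), (S : Set (Fact τ U)) ⊆ 𝓘.facts →
    𝓘.Pr {I | ∀ f ∈ S, f ∈ I} = ∏ f ∈ S, 𝓘.Pr {I | f ∈ I}

/-- `𝓓 = V(𝓘)`: the view `V` maps the sample space of `𝓘` to that of `𝓓`, and
`P'({D'}) = P({D | V(D) = D'})`. -/
def PDB.IsImage {σ τ : Schema} {U : Type u} (V : FOView σ τ U) (𝓘 : PDB σ U) (𝓓 : PDB τ U) :
    Prop :=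
  Set.MapsTo V.apply 𝓘.space 𝓓.space ∧
    ∀ D' ∈ 𝓓.space, 𝓓.prob D' = 𝓘.Pr {D | D ∈ 𝓘.space ∧ V.apply D = D'}

/-- The class `FO(TI)`: the images of tuple-independent PDBs, over an arbitrary schema and the
same universe, under first-order views. -/
def PDB.InFOTI {τ : Schema} {U : Type u} (𝓓 : PDB τ U) : Prop :=
  ∃ (σ : Schema) (𝓘 : PDB σ U) (V : FOView σ τ U), 𝓘.IsTI ∧ PDB.IsImage V 𝓘 𝓓

/-- All instances in the set have size at most some fixed bound. -/
def BoundedSize {τ : Schema} {U : Type u} (𝔻 : Set (Inst τ U)) : Prop :=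
  ∃ c : ℕ, ∀ D ∈ 𝔻, D.card ≤ c

/-- For every `n` the set contains an instance of size at least `n`. -/
def UnboundedSize {τ : Schema} {U : Type u} (𝔻 : Set (Inst τ U)) : Prop :=
  ∀ n : ℕ, ∃ D ∈ 𝔻, n ≤ D.card

end ProbDB

open MeasureTheory ProbabilityTheory Filter Topology
open scoped ENNReal

/-! Membership rests on the criterion `PDB.inFOTI_of_summable`. World `n` is cut into `len n` cells,
each a fact carrying at most `K` facts of that world; the cells occur independently, and those of
group `n` have probability `Q n ^ (1 / len n)`, so the whole group is present with probability `Q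
n`. Each cell names its successor on a cycle, so a first-order formula recognises a complete group
as a nonempty one closed under successors. The view decodes the complete group of strictly smallest
class, and group `0`, which is always complete, when there is none.

Relation symbols record the classes, so there can be only finitely many; hence all indices `≥ N`
share one class, and a tie falls back to `0`. `exists_activation` finds `Q` for which the selected
index still has the prescribed law `p`: below `N` by dividing by the remaining mass, above `N` by
solving a fixed-point equation. As `Q n ≤ C * p n`, summability of `len n * s n` with `p n ≤ s n ^
len n` makes the marginals summable, so almost surely finitely many cells occur. Worlds of bounded
size fit into one cell each, so every distribution qualifies; for arbitrary worlds a rapidly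
decreasing distribution does.

Non-membership comes from expected size. By the second Borel–Cantelli lemma the marginals of a
tuple-independent PDB are summable, hence `E[2 ^ |I|] = ∑_S ∏_{f ∈ S} Pr(f ∈ I)` is finite. A view
enlarges instances only polynomially, so its image has finite expected size
(`PDB.InFOTI.tsum_card_ne_top`), whereas unbounded worlds can be weighted so that the expected size
is infinite. -/

namespace ProbDB

/-! ### Properties definable independently of the quantifier range -/

/-- A property of instances and valuations is definable if some formula expresses it for every
quantifier range that contains the active domain. -/
def Definable {σ : Schema} {U : Type u} {n : ℕ} (P : Inst σ U → (Fin n → U) → Prop) : Prop :=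
  ∃ φ : Formula σ U n, ∀ D A v, adom D ⊆ A → (φ.SatIn D A v ↔ P D v)

namespace Definable

variable {σ : Schema} {U : Type u} {n : ℕ} {P Q : Inst σ U → (Fin n → U) → Prop}

theorem congr (hP : Definable P) (h : ∀ D v, P D v ↔ Q D v) : Definable Q := by
  obtain ⟨φ, hφ⟩ := hP
  exact ⟨φ, fun D A v hA => (hφ D A v hA).trans (h D v)⟩

theorem eq (i j : Fin n) : Definable fun (_ : Inst σ U) v => v i = v j :=
  ⟨.eq i (.var j), fun _ _ _ _ => Iff.rfl⟩

theorem not (hP : Definable P) : Definable fun D v => ¬ P D v := by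
  obtain ⟨φ, hφ⟩ := hP
  exact ⟨.not φ, fun D A v hA => not_congr (hφ D A v hA)⟩

theorem and (hP : Definable P) (hQ : Definable Q) : Definable fun D v => P D v ∧ Q D v := by
  obtain ⟨φ, hφ⟩ := hP
  obtain ⟨ψ, hψ⟩ := hQ
  exact ⟨.and φ ψ, fun D A v hA => and_congr (hφ D A v hA) (hψ D A v hA)⟩

theorem or (hP : Definable P) (hQ : Definable Q) : Definable fun D v => P D v ∨ Q D v := by
  obtain ⟨φ, hφ⟩ := hP
  obtain ⟨ψ, hψ⟩ := hQ
  exact ⟨.or φ ψ, fun D A v hA => or_congr (hφ D A v hA) (hψ D A v hA)⟩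

theorem imp (hP : Definable P) (hQ : Definable Q) : Definable fun D v => P D v → Q D v :=
  (hP.not.or hQ).congr fun _ _ => imp_iff_not_or.symm

theorem false : Definable fun (_ : Inst σ U) (_ : Fin n → U) => False := by
  -- An equality atom needs a variable on its left, and none is in scope when `n = 0`; the
  -- quantifier supplies one.
  refine ⟨.ex (.not (.eq (Fin.last n) (.var (Fin.last n)))), fun D A v _ => ?_⟩
  simp [Formula.SatIn, FOTerm.val]

theorem const (p : Prop) : Definable fun (_ : Inst σ U) (_ : Fin n → U) => p := by
  by_cases hp : p
  · exact Definable.false.not.congr fun _ _ => by simp [hp]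
  · exact Definable.false.congr fun _ _ => by simp [hp]

theorem exists_finite {ι : Type*} [Finite ι] {P : ι → Inst σ U → (Fin n → U) → Prop}
    (hP : ∀ i, Definable (P i)) : Definable fun D v => ∃ i, P i D v := by
  classical
  cases nonempty_fintype ι
  have key : ∀ s : Finset ι, Definable fun D v => ∃ i ∈ s, P i D v := by
    intro s
    induction s using Finset.induction_on with
    | empty => exact Definable.false.congr fun _ _ => by simp
    | insert a s _ ih => exact ((hP a).or ih).congr fun _ _ => by simp
  exact (key Finset.univ).congr fun _ _ => by simp

theorem forall_finite {ι : Type*} [Finite ι] {P : ι → Inst σ U → (Fin n → U) → Prop}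
    (hP : ∀ i, Definable (P i)) : Definable fun D v => ∀ i, P i D v :=
  (exists_finite fun i => (hP i).not).not.congr fun _ _ => by simp

/-- The guard forces every witness into the active domain, so enlarging the quantifier range by the
constants of the formula changes nothing. -/
theorem exists_guarded {P : Inst σ U → (Fin (n + 1) → U) → Prop} (hP : Definable P)
    (hg : ∀ D v a, P D (Fin.snoc v a : Fin (n + 1) → U) → a ∈ adom D) :
    Definable fun D v => ∃ a, P D (Fin.snoc v a : Fin (n + 1) → U) := by
  obtain ⟨φ, hφ⟩ := hP
  refine ⟨.ex φ, fun D A v hA => ?_⟩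
  simp only [Formula.SatIn, hφ D A _ hA]
  exact ⟨fun ⟨a, _, h⟩ => ⟨a, h⟩, fun ⟨a, h⟩ => ⟨a, hA (hg _ _ _ h), h⟩⟩

theorem exists_tuple_guarded : ∀ (m : ℕ) {P : Inst σ U → (Fin (n + m) → U) → Prop},
    Definable P →
    (∀ D v w, P D (Fin.append v w) → ∀ i : Fin m, w i ∈ adom D) →
    Definable fun D v => ∃ w : Fin m → U, P D (Fin.append v w)
  | 0, P, hP, _ => hP.congr fun D v => by
      constructor
      · intro h
        refine ⟨Fin.elim0, ?_⟩
        rwa [Fin.append_right_nil _ _ rfl]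
      · rintro ⟨w, h⟩
        rwa [Fin.append_right_nil _ _ rfl] at h
  | m + 1, P, hP, hg => by
      have h1 : Definable fun D (v : Fin (n + m) → U) =>
          ∃ a, P D (Fin.snoc v a : Fin (n + m + 1) → U) := by
        refine hP.exists_guarded (P := P) fun D v a h => ?_
        have := hg D (fun i => v (Fin.castAdd m i))
          (Fin.snoc (fun i => v (Fin.natAdd n i)) a : Fin (m + 1) → U) (by
            rw [Fin.append_snoc]
            simpa [Fin.append_castAdd_natAdd] using h) (Fin.last m)
        simpa using this
      refine (exists_tuple_guarded m h1 ?_).congr fun D v => ?_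
      · rintro D v w ⟨a, h⟩ i
        rw [← Fin.append_snoc] at h
        simpa using hg D v _ h i.castSucc
      · constructor
        · rintro ⟨w, a, h⟩
          rw [← Fin.append_snoc] at h
          exact ⟨_, h⟩
        · rintro ⟨w, h⟩
          refine ⟨Fin.init w, w (Fin.last m), ?_⟩
          rw [← Fin.append_snoc, Fin.snoc_init_self]
          exact h

/-- Quantification over the facts of an instance with a given relation symbol. -/
theorem exists_fact (r : σ.Rel) {P : Inst σ U → (Fin (n + σ.ar r) → U) → Prop}
    (hP : Definable P) :
    Definable fun D v => ∃ w, (⟨r, w⟩ : Fact σ U) ∈ D ∧ P D (Fin.append v w) := by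
  have h1 : Definable fun (D : Inst σ U) (v : Fin (n + σ.ar r) → U) =>
      (⟨r, fun i => v (Fin.natAdd n i)⟩ : Fact σ U) ∈ D :=
    ⟨.rel r fun i => .var (Fin.natAdd n i), fun _ _ _ _ => Iff.rfl⟩
  refine (exists_tuple_guarded (σ.ar r) (h1.and hP) ?_).congr fun D v => by
    simp only [Fin.append_right]
  rintro D v w ⟨h, -⟩ i
  simp only [Fin.append_right] at h
  exact ⟨_, h, i, rfl⟩

theorem forall_fact (r : σ.Rel) {P : Inst σ U → (Fin (n + σ.ar r) → U) → Prop}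
    (hP : Definable P) :
    Definable fun D v => ∀ w, (⟨r, w⟩ : Fact σ U) ∈ D → P D (Fin.append v w) :=
  (exists_fact r hP.not).not.congr fun _ _ => by simp

end Definable

/-- Definable properties of tuples over the active domain yield a view. -/
theorem exists_view {σ τ : Schema} {U : Type u}
    {P : (R : τ.Rel) → Inst σ U → (Fin (τ.ar R) → U) → Prop} (hP : ∀ R, Definable (P R))
    (hg : ∀ R D v, P R D v → ∀ i, v i ∈ adom D) :
    ∃ V : FOView σ τ U, ∀ D f, f ∈ V.apply D ↔ P f.1 D f.2 := by
  choose φ hφ using hP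
  refine ⟨φ, fun D f => ?_⟩
  refine (FOView.mem_apply (V := φ) D f).trans ?_
  have h := hφ f.1 D ((φ f.1).adom D) f.2 Set.subset_union_left
  exact ⟨fun h' => h.1 h'.2, fun h' => ⟨fun i => Or.inl (hg _ _ _ h' i), h.2 h'⟩⟩

/-! ### Random finite sets with independent elements -/

theorem exists_isProbabilityMeasure_bool (q : ℝ≥0∞) (hq : q ≤ 1) :
    ∃ μ : Measure Bool, IsProbabilityMeasure μ ∧ μ {true} = q := by
  refine ⟨(PMF.ofFintype (fun b => cond b q (1 - q)) ?_).toMeasure, inferInstance, ?_⟩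
  · simp [add_tsub_cancel_of_le hq]
  · rw [PMF.toMeasure_apply_singleton _ _ (measurableSet_singleton _)]
    simp

/-- Given marginals with a finite sum, there is a random finite set that contains its potential
elements independently with these marginals. -/
theorem exists_independent_finset {F : Type*} [Countable F] (q : F → ℝ≥0∞) (hq : ∀ f, q f ≤ 1)
    (hs : ∑' f, q f ≠ ∞) :
    ∃ P : PMF (Finset F), ∀ S : Finset F,
      P.toOuterMeasure {I | ∀ f ∈ S, f ∈ I} = ∏ f ∈ S, q f := by
  classical
  choose μ hμ hμq using fun f => exists_isProbabilityMeasure_bool (q f) (hq f)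
  let ν : Measure (F → Bool) := Measure.infinitePi μ
  have hν : ∀ S : Finset F, ν {ω | ∀ f ∈ S, ω f = true} = ∏ f ∈ S, q f := by
    intro S
    have := Measure.infinitePi_pi (μ := μ) (s := S) (t := fun _ => {true})
      (fun _ _ => measurableSet_singleton _)
    simp only [hμq] at this
    rw [← this]
    rfl
  -- First Borel–Cantelli lemma; this is where summability of the marginals enters.
  have hfin : ∀ᵐ ω ∂ν, {f | ω f = true}.Finite := by
    have h := measure_limsup_cofinite_eq_zero (μ := ν) (s := fun f => {ω : F → Bool | ω f = true})
      (by
        convert hs using 3 with f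
        simpa using hν {f})
    rw [Filter.cofinite.limsup_set_eq] at h
    rw [ae_iff]
    exact h
  -- The value `∅` is taken only on the null event that infinitely many coordinates are true.
  let g : (F → Bool) → Finset F := fun ω =>
    if h : {f | ω f = true}.Finite then h.toFinset else ∅
  let _ : MeasurableSpace (Finset F) := ⊤
  have hgm : Measurable g := by
    have hmem : ∀ (f : F) (b : Bool), MeasurableSet {ω : F → Bool | ω f = b} := fun f b =>
      (measurable_pi_apply f : Measurable fun ω : F → Bool => ω f) (measurableSet_singleton b)
    have hF : MeasurableSet {ω : F → Bool | {f | ω f = true}.Finite} := by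
      have : {ω : F → Bool | {f | ω f = true}.Finite} =
          ⋃ T : Finset F, ⋂ f : F, {ω | f ∉ T → ω f ≠ true} := by
        ext ω
        simp only [Set.mem_ofPred_eq, Set.mem_iUnion, Set.mem_iInter]
        constructor
        · intro h
          exact ⟨h.toFinset, fun f hf => by simpa using hf⟩
        · rintro ⟨T, hT⟩
          exact T.finite_toSet.subset fun f hf => by
            by_contra h
            exact hT f (by simpa using h) hf
      rw [this]
      refine MeasurableSet.iUnion fun T => MeasurableSet.iInter fun f => ?_
      by_cases hf : f ∈ T
      · simp [hf]
      · simpa only [hf, not_false_eq_true, true_imp_iff, ne_eq, Bool.not_eq_true] using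
          hmem f false
    refine measurable_to_countable' fun T => ?_
    have : g ⁻¹' {T} = {ω : F → Bool | {f | ω f = true}.Finite} ∩
        (⋂ f : F, {ω | ω f = true ↔ f ∈ T}) ∪
        ({ω : F → Bool | {f | ω f = true}.Finite}ᶜ ∩ {_ω | T = ∅}) := by
      ext ω
      by_cases h : {f | ω f = true}.Finite
      · have h' : g ω = T ↔ ∀ f, ω f = true ↔ f ∈ T := by
          rw [Finset.ext_iff]
          simp only [g, dif_pos h, Set.Finite.mem_toFinset, Set.mem_ofPred_eq]
        simpa [h] using h'
      · have h' : g ω = ∅ := dif_neg h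
        simpa [h, h'] using eq_comm
    rw [this]
    refine (hF.inter (MeasurableSet.iInter fun f => ?_)).union (hF.compl.inter (.const _))
    by_cases hf : f ∈ T
    · simpa only [hf, iff_true] using hmem f true
    · simpa only [hf, iff_false, Bool.not_eq_true] using hmem f false
  have : IsProbabilityMeasure (ν.map g) := Measure.isProbabilityMeasure_map hgm.aemeasurable
  refine ⟨(ν.map g).toPMF, fun S => ?_⟩
  rw [← PMF.toMeasure_apply_eq_toOuterMeasure, Measure.toPMF_toMeasure,
    Measure.map_apply hgm trivial, ← hν S]
  refine measure_congr ?_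
  filter_upwards [hfin] with ω hω
  simp only [eq_iff_iff]
  change (∀ f ∈ S, f ∈ g ω) ↔ ∀ f ∈ S, ω f = true
  simp [g, hω]

/-! ### Activation probabilities realizing a given law -/

/-- A fixed point of `t ↦ ∏ (1 + t xⱼ)`. -/
theorem exists_tendsto_prod_one_add_mul {x : ℕ → ℝ} (hx : ∀ n, 0 ≤ x n)
    (hs : ∀ n, ∑ j ∈ Finset.range n, x j ≤ 1 / 4) :
    ∃ t : ℝ, 1 ≤ t ∧ t ≤ 2 ∧
      Tendsto (fun n => ∏ j ∈ Finset.range n, (1 + t * x j)) atTop (𝓝 t) := by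
  -- Over `ℝ≥0∞` the infinite product is a monotone map of a complete lattice, so Knaster–Tarski
  -- yields a least fixed point. Since `exp (2 * (1 / 4)) ≤ 2`, the point `2` is mapped below itself
  -- and bounds that fixed point.
  let f : ℝ≥0∞ →o ℝ≥0∞ :=
    ⟨fun t => ⨆ n, ∏ j ∈ Finset.range n, (1 + t * ENNReal.ofReal (x j)), fun a b hab => by
      dsimp only
      gcongr⟩
  have h2 : f 2 ≤ 2 := by
    refine iSup_le fun n => ?_
    have h1 : ∏ j ∈ Finset.range n, (1 + 2 * x j) ≤ 2 := by
      calc ∏ j ∈ Finset.range n, (1 + 2 * x j) ≤ ∏ j ∈ Finset.range n, Real.exp (2 * x j) := by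
            refine Finset.prod_le_prod (fun j _ => by have := hx j; positivity) fun j _ => ?_
            linarith [Real.add_one_le_exp (2 * x j)]
        _ = Real.exp (∑ j ∈ Finset.range n, 2 * x j) := (Real.exp_sum _ _).symm
        _ ≤ Real.exp (1 / 2) := by
            rw [← Finset.mul_sum]
            exact Real.exp_le_exp.2 (by linarith [hs n])
        _ ≤ 2 := by
            have e1 := Real.exp_one_lt_d9
            have e2 : Real.exp (1 / 2) * Real.exp (1 / 2) = Real.exp 1 := by
              rw [← Real.exp_add]; norm_num
            nlinarith [Real.exp_pos (1 / 2)]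
    have h3 : ∏ j ∈ Finset.range n, (1 + 2 * ENNReal.ofReal (x j)) =
        ENNReal.ofReal (∏ j ∈ Finset.range n, (1 + 2 * x j)) := by
      rw [ENNReal.ofReal_prod_of_nonneg fun j _ => by have := hx j; positivity]
      refine Finset.prod_congr rfl fun j _ => ?_
      rw [ENNReal.ofReal_add zero_le_one (by have := hx j; positivity),
        ENNReal.ofReal_mul zero_le_two]
      simp
    rw [h3]
    exact (ENNReal.ofReal_le_ofReal h1).trans (by simp)
  set t := f.lfp with ht
  have ht2 : t ≤ 2 := f.lfp_le h2
  have htf : f t = t := f.map_lfp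
  have ht1 : 1 ≤ t := by
    rw [← htf]
    exact le_iSup_of_le 0 (by simp)
  have htop : t ≠ ∞ := ne_top_of_le_ne_top (by simp) ht2
  refine ⟨t.toReal, ?_, ?_, ?_⟩
  · simpa using (ENNReal.toReal_le_toReal (by simp) htop).2 ht1
  · simpa using (ENNReal.toReal_le_toReal htop (by simp)).2 ht2
  · have hmono : Monotone fun n => ∏ j ∈ Finset.range n, (1 + t * ENNReal.ofReal (x j)) := by
      refine monotone_nat_of_le_succ fun n => ?_
      rw [Finset.prod_range_succ]
      exact le_mul_of_one_le_right (by simp) le_self_add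
    have h := tendsto_atTop_iSup hmono
    change Tendsto _ _ (𝓝 (f t)) at h
    rw [htf] at h
    refine ((ENNReal.tendsto_toReal htop).comp h).congr fun n => ?_
    simp only [Function.comp, ENNReal.toReal_prod]
    refine Finset.prod_congr rfl fun j _ => ?_
    rw [ENNReal.toReal_add (by simp) (ENNReal.mul_ne_top htop (by simp))]
    simp [ENNReal.toReal_ofReal (hx j)]

/-- Activation probabilities that realize the distribution `p` when the activated index of
strictly best priority is selected, where all indices `≥ N` share their priority. -/
theorem exists_activation {p : ℕ → ℝ} (hp : ∀ n, 0 ≤ p n) (hp0 : 0 < p 0) (hsum : HasSum p 1) :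
    ∃ (N : ℕ) (Q : ℕ → ℝ) (C z : ℝ), 1 ≤ N ∧ 1 ≤ C ∧ Q 0 = 1 ∧ (∀ n, 0 ≤ Q n) ∧
      (∀ n, 1 ≤ n → Q n < 1) ∧ (∀ n, Q n ≤ C * p n) ∧
      (∀ n, 1 ≤ n → n < N → Q n * ∏ j ∈ Finset.Ico 1 n, (1 - Q j) = p n) ∧
      Tendsto (fun m => ∏ j ∈ Finset.Ico 1 m, (1 - Q j)) atTop (𝓝 z) ∧
      (∀ n, N ≤ n → Q n * z = p n * (1 - Q n)) := by
  have hle : ∀ s : Finset ℕ, ∑ j ∈ s, p j ≤ 1 := fun s => sum_le_hasSum s (fun i _ => hp i) hsum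
  let r : ℕ → ℝ := fun n => 1 - ∑ j ∈ Finset.Ico 1 n, p j
  have hr : ∀ n, p 0 ≤ r n := by
    intro n
    have := hle (insert 0 (Finset.Ico 1 n))
    rw [Finset.sum_insert (by simp)] at this
    simp only [r]
    linarith
  have hr0 : ∀ n, 0 < r n := fun n => hp0.trans_le (hr n)
  -- The mass from `N` on is at most `p 0 / 4 ≤ r N / 4`, which is the smallness that the fixed
  -- point needs.
  obtain ⟨N, hN1, hN⟩ : ∃ N, 1 ≤ N ∧ 1 - p 0 / 4 ≤ ∑ j ∈ Finset.range N, p j := by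
    have h := (hsum.tendsto_sum_nat.eventually (lt_mem_nhds
      (show 1 - p 0 / 4 < 1 by linarith))).and (eventually_ge_atTop 1)
    obtain ⟨N, h1, h2⟩ := h.exists
    exact ⟨N, h2, h1.le⟩
  let x : ℕ → ℝ := fun n => if n < N then 0 else p n / r N
  have hx : ∀ n, 0 ≤ x n := by
    intro n
    simp only [x]
    split_ifs
    · exact le_rfl
    · exact div_nonneg (hp n) (hr0 N).le
  have hxs : ∀ n, ∑ j ∈ Finset.range n, x j ≤ 1 / 4 := by
    intro n
    have h1 : ∑ j ∈ Finset.range n, x j = (∑ j ∈ Finset.Ico N n, p j) / r N := by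
      rw [Finset.sum_div, ← Finset.sum_filter_add_sum_filter_not (Finset.range n) (· < N)]
      have : ∑ j ∈ (Finset.range n).filter (· < N), x j = 0 :=
        Finset.sum_eq_zero fun j hj => by simp [x, (Finset.mem_filter.1 hj).2]
      rw [this, zero_add]
      refine Finset.sum_congr ?_ fun j hj => ?_
      · ext j
        simp [and_comm]
      · simp [x, (Finset.mem_Ico.1 hj).1]
    rw [h1, div_le_iff₀ (hr0 N)]
    have h2 := hle (Finset.range N ∪ Finset.Ico N n)
    rw [Finset.sum_union (by
      rw [Finset.disjoint_left]
      intro a ha hb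
      simp at ha hb
      omega)] at h2
    linarith [hr N]
  obtain ⟨t, ht1, ht2, ht⟩ := exists_tendsto_prod_one_add_mul hx hxs
  have ht0 : 0 < t := by linarith
  have htx : ∀ n, 0 < 1 + t * x n := fun n => by have := hx n; positivity
  -- Below `N`, `Q n` is the conditional probability of `n` given that no smaller positive index was
  -- drawn. From `N` on, the odds `Q n / (1 - Q n)` must equal `p n / z`; with odds `t * x n` the
  -- limit is `z = r N / ∏ (1 + t * x j)`, so the condition becomes that `t` equals this product.
  let Q : ℕ → ℝ := fun n =>
    if n = 0 then 1 else if n < N then p n / r n else t * x n / (1 + t * x n)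
  have hQ0 : Q 0 = 1 := by simp [Q]
  have hQs : ∀ n, 1 ≤ n → n < N → Q n = p n / r n := fun n h1 h2 => by
    simp [Q, h2, show n ≠ 0 by omega]
  have hQl : ∀ n, N ≤ n → Q n = t * x n / (1 + t * x n) := fun n h => by
    simp [Q, show ¬ n < N by omega, show n ≠ 0 by omega]
  have hrs : ∀ n, 1 ≤ n → r (n + 1) = r n - p n := fun n hn => by
    simp only [r]
    rw [Finset.sum_Ico_succ_top hn]
    ring
  have hprod : ∀ n, 1 ≤ n → n ≤ N → ∏ j ∈ Finset.Ico 1 n, (1 - Q j) = r n := by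
    intro n hn
    induction n, hn using Nat.le_induction with
    | base => simp [r]
    | succ n hn ih =>
      intro hnN
      rw [Finset.prod_Ico_succ_top hn, ih (by omega), hQs n hn (by omega), hrs n hn]
      have := (hr0 n).ne'
      field_simp
  have hprod2 : ∀ m, N ≤ m →
      ∏ j ∈ Finset.Ico 1 m, (1 - Q j) = r N / ∏ j ∈ Finset.range m, (1 + t * x j) := by
    intro m hm
    induction m, hm using Nat.le_induction with
    | base =>
      rw [hprod N hN1 le_rfl, Finset.prod_eq_one, div_one]
      intro j hj
      simp [x, Finset.mem_range.1 hj]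
    | succ m hm ih =>
      rw [Finset.prod_Ico_succ_top (by omega), ih, hQl m hm, Finset.prod_range_succ]
      have h1 := (htx m).ne'
      have h2 : ∏ j ∈ Finset.range m, (1 + t * x j) ≠ 0 :=
        (Finset.prod_pos fun j _ => htx j).ne'
      field_simp
      ring
  have hp01 : p 0 ≤ 1 := by simpa using hle {0}
  -- `2 / p 0` suffices because `r n ≥ p 0` and `t ≤ 2`.
  refine ⟨N, Q, 2 / p 0, r N / t, hN1, ?_, hQ0, ?_, ?_, ?_, ?_, ?_, ?_⟩
  · rw [le_div_iff₀ hp0]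
    linarith
  · intro n
    simp only [Q]
    have := hx n
    have := hp n
    have := hr0 n
    split_ifs <;> positivity
  · intro n hn
    rcases lt_or_ge n N with h | h
    · rw [hQs n hn h, div_lt_one (hr0 n)]
      linarith [hr (n + 1), hrs n hn]
    · rw [hQl n h, div_lt_one (htx n)]
      linarith
  · intro n
    rw [div_mul_eq_mul_div, le_div_iff₀ hp0]
    rcases Nat.eq_zero_or_pos n with rfl | hn
    · rw [hQ0]
      linarith
    rcases lt_or_ge n N with h | h
    · rw [hQs n hn h, div_mul_eq_mul_div, div_le_iff₀ (hr0 n)]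
      nlinarith [hr n, hp n, mul_nonneg (hp n) (hr0 n).le, mul_nonneg (hp n) (sub_nonneg.2 (hr n))]
    · have h1 : Q n ≤ 2 * x n := by
        rw [hQl n h, div_le_iff₀ (htx n)]
        nlinarith [hx n, mul_nonneg ht0.le (mul_nonneg (hx n) (hx n)),
          mul_nonneg (sub_nonneg.2 ht2) (hx n)]
      have h2 : x n * p 0 ≤ p n := by
        simp only [x, if_neg (not_lt.2 h)]
        rw [div_mul_eq_mul_div, div_le_iff₀ (hr0 N)]
        nlinarith [hr N, hp n]
      nlinarith
  · intro n hn h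
    rw [hprod n hn h.le, hQs n hn h, div_mul_cancel₀ _ (hr0 n).ne']
  · refine (tendsto_const_nhds.div ht ht0.ne').congr' ?_
    filter_upwards [eventually_ge_atTop N] with m hm
    exact (hprod2 m hm).symm
  · intro n hn
    have h1 := (htx n).ne'
    have h3 := (hr0 N).ne'
    have h4 : p n = x n * r N := by
      simp only [x, if_neg (not_lt.2 hn)]
      field_simp
    rw [hQl n hn, h4]
    field_simp
    ring

/-! ### The law of the selected index -/

/-- Total mass one determines the last value. It spares computing the probability of index `0`,
which absorbs every tie. -/
theorem pmf_ext_of_ne {α : Type*} {μ ν : PMF α} (a : α) (h : ∀ b, b ≠ a → μ b = ν b) : μ = ν := by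
  classical
  refine PMF.ext fun b => ?_
  rcases eq_or_ne b a with rfl | hb
  · have h1 := μ.tsum_coe
    have h2 := ν.tsum_coe
    rw [ENNReal.tsum_eq_add_tsum_ite b] at h1 h2
    have h3 : (∑' x, if x = b then 0 else μ x) = ∑' x, if x = b then 0 else ν x :=
      tsum_congr fun x => by
        split_ifs with hx
        · rfl
        · exact h x hx
    rw [← h2, h3] at h1
    refine (ENNReal.add_left_inj ?_).1 h1
    rw [← h3]
    exact ne_top_of_le_ne_top μ.tsum_coe_ne_top
      (ENNReal.tsum_le_tsum fun x => by split_ifs <;> simp)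
  · exact h b hb

/-- `i` is the element of `X` of strictly smallest class. -/
def IsSelected (c : ℕ → ℕ) (X : Set ℕ) (i : ℕ) : Prop :=
  i ∈ X ∧ ∀ j ∈ X, j ≠ i → c i < c j

theorem IsSelected.unique {c : ℕ → ℕ} {X : Set ℕ} {i j : ℕ} (hi : IsSelected c X i)
    (hj : IsSelected c X j) : i = j := by
  by_contra h
  exact (hi.2 j hj.1 (Ne.symm h)).asymm (hj.2 i hi.1 h)

open Classical in
/-- The selected index, or `0` if there is none. -/
noncomputable def select (c : ℕ → ℕ) (X : Set ℕ) : ℕ :=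
  if h : ∃ i, IsSelected c X i then h.choose else 0

theorem IsSelected.select_eq {c : ℕ → ℕ} {X : Set ℕ} {i : ℕ} (hi : IsSelected c X i) :
    select c X = i := by
  have h : ∃ i, IsSelected c X i := ⟨i, hi⟩
  rw [select, dif_pos h]
  exact h.choose_spec.unique hi

theorem select_eq_zero {c : ℕ → ℕ} {X : Set ℕ} (h : ¬ ∃ i, IsSelected c X i) :
    select c X = 0 := dif_neg h

theorem select_eq_iff {c : ℕ → ℕ} {X : Set ℕ} {i : ℕ} (hi : i ≠ 0) :
    select c X = i ↔ IsSelected c X i := by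
  refine ⟨fun h => ?_, IsSelected.select_eq⟩
  by_cases h' : ∃ i, IsSelected c X i
  · obtain ⟨j, hj⟩ := h'
    rwa [← h, hj.select_eq]
  · exact absurd (h ▸ select_eq_zero h') hi

/-- The class of an index: `0` comes last, all indices `≥ N` are in the same class. -/
def indexClass (N n : ℕ) : ℕ := if n = 0 then N + 1 else min n N

theorem indexClass_le (N n : ℕ) : indexClass N n ≤ N + 1 := by
  unfold indexClass
  split_ifs <;> omega

/-- Classes below `N` are singletons and `0` ranks last, so only smaller positive indices compete.
-/
theorem isSelected_indexClass_lt {N n : ℕ} {X : Set ℕ} (h1 : 1 ≤ n) (h2 : n < N) :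
    IsSelected (indexClass N) X n ↔ n ∈ X ∧ ∀ j ∈ Finset.Ico 1 n, j ∉ X := by
  refine and_congr_right fun _ => forall_congr' fun j => ?_
  have : (j ≠ n → indexClass N n < indexClass N j) ↔ j ∉ Finset.Ico 1 n := by
    simp only [indexClass, Finset.mem_Ico]
    split_ifs <;> omega
  rw [this]
  tauto

/-- Every other positive index has class at most `N`, so each of them must be absent. Stating this
through finite intervals presents the event as a decreasing intersection. -/
theorem isSelected_indexClass_ge {N n : ℕ} {X : Set ℕ} (h1 : 1 ≤ N) (h2 : N ≤ n) :
    IsSelected (indexClass N) X n ↔ n ∈ X ∧ ∀ m, ∀ j ∈ (Finset.Ico 1 m).erase n, j ∉ X := by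
  refine and_congr_right fun _ => ?_
  have : ∀ j, (j ≠ n → indexClass N n < indexClass N j) ↔ ¬ (1 ≤ j ∧ j ≠ n) := by
    intro j
    simp only [indexClass]
    split_ifs <;> omega
  simp only [this, Finset.mem_erase, Finset.mem_Ico]
  constructor
  · intro h m j hj hX
    exact h j hX ⟨hj.2.1, hj.1⟩
  · intro h j hX hj
    exact h (j + 1) j ⟨hj.2, hj.1, by omega⟩ hX

theorem map_select_eq {Ω : Type*} (P : PMF Ω) (X : Ω → Set ℕ) (p : PMF ℕ) {N : ℕ} {Q : ℕ → ℝ}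
    {z : ℝ} (hN : 1 ≤ N) (hQ0 : ∀ n, 0 ≤ Q n) (hQ1 : ∀ n, 1 ≤ n → Q n < 1)
    (hs : ∀ n, 1 ≤ n → n < N → Q n * ∏ j ∈ Finset.Ico 1 n, (1 - Q j) = (p n).toReal)
    (ht : Tendsto (fun m => ∏ j ∈ Finset.Ico 1 m, (1 - Q j)) atTop (𝓝 z))
    (hz : ∀ n, N ≤ n → Q n * z = (p n).toReal * (1 - Q n))
    (hind : ∀ S : Finset ℕ,
      P.toOuterMeasure {ω | ∀ n ∈ S, n ∈ X ω} = ∏ n ∈ S, ENNReal.ofReal (Q n)) :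
    P.map (fun ω => select (indexClass N) (X ω)) = p := by
  classical
  let _ : MeasurableSpace Ω := ⊤
  let μ : Measure Ω := P.toMeasure
  have hμ : ∀ A : Set Ω, μ A = P.toOuterMeasure A := fun A =>
    P.toMeasure_apply_eq_toOuterMeasure_apply trivial
  let C : ℕ → Set Ω := fun n => {ω | n ∈ X ω}
  have hC : ∀ n, μ (C n) = ENNReal.ofReal (Q n) := fun n => by
    rw [hμ]
    simpa using hind {n}
  have hCi : iIndepSet C μ := by
    rw [iIndepSet_iff_meas_biInter fun n => show MeasurableSet (C n) from trivial]
    intro S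
    simp only [hC]
    rw [← hind S, ← hμ]
    congr 1
    ext ω
    simp [C]
  have key : ∀ (n : ℕ) (S : Finset ℕ), n ∉ S →
      μ.real (C n ∩ ⋂ j ∈ S, (C j)ᶜ) = Q n * ∏ j ∈ S, (1 - Q j) := by
    intro n S hn
    -- Independence of the generated σ-algebras allows the events for `j ∈ S` to be replaced by
    -- their complements.
    have h1 := ((iIndepSet_iff_iIndep C μ).1 hCi).meas_biInter (S := insert n S)
      (s := fun j => if j = n then C j else (C j)ᶜ) (fun j _ => by
        have h : MeasurableSet[MeasurableSpace.generateFrom {C j}] (C j) :=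
          MeasurableSpace.measurableSet_generateFrom rfl
        split_ifs
        · exact h
        · exact h.compl)
    rw [Finset.set_biInter_insert, Finset.prod_insert hn] at h1
    simp only [if_true] at h1
    have h2 : ∀ j ∈ S, j ≠ n := fun j hj h => hn (h ▸ hj)
    rw [Set.iInter₂_congr (t := fun j _ => (C j)ᶜ) fun j hj => if_neg (h2 j hj),
      Finset.prod_congr rfl fun j hj => by rw [if_neg (h2 j hj)]] at h1
    have h3 : ∀ j, μ.real (C j) = Q j := fun j => by
      rw [Measure.real, hC, ENNReal.toReal_ofReal (hQ0 j)]
    rw [Measure.real, h1, ENNReal.toReal_mul, ENNReal.toReal_prod]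
    congr 1
    · exact h3 n
    · refine Finset.prod_congr rfl fun j _ => ?_
      have := probReal_compl_eq_one_sub (μ := μ) (s := C j) trivial
      rwa [h3] at this
  refine pmf_ext_of_ne 0 fun n hn => ?_
  have hn1 : 1 ≤ n := Nat.one_le_iff_ne_zero.2 hn
  have hmap : P.map (fun ω => select (indexClass N) (X ω)) n =
      μ {ω | IsSelected (indexClass N) (X ω) n} := by
    rw [← PMF.toOuterMeasure_apply_singleton, PMF.toOuterMeasure_map_apply, hμ]
    congr 1
    ext ω
    exact select_eq_iff hn
  rw [hmap, ← ENNReal.toReal_eq_toReal_iff' (measure_ne_top _ _) (p.apply_ne_top n)]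
  change μ.real _ = _
  rcases lt_or_ge n N with h | h
  · rw [← hs n hn1 h, ← key n _ (by simp)]
    congr 1
    ext ω
    simp only [Set.mem_ofPred_eq, isSelected_indexClass_lt hn1 h]
    simp [C]
  · have hset : {ω | IsSelected (indexClass N) (X ω) n} =
        ⋂ m : ℕ, (C n ∩ ⋂ j ∈ (Finset.Ico 1 m).erase n, (C j)ᶜ) := by
      ext ω
      simp only [Set.mem_ofPred_eq, isSelected_indexClass_ge hN h, ← Set.inter_iInter]
      simp only [Set.mem_inter_iff, Set.mem_iInter, Set.mem_compl_iff, C, Set.mem_ofPred_eq]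
    have hlim : Tendsto (fun m => μ.real (C n ∩ ⋂ j ∈ (Finset.Ico 1 m).erase n, (C j)ᶜ)) atTop
        (𝓝 (μ.real {ω | IsSelected (indexClass N) (X ω) n})) := by
      rw [hset]
      refine (ENNReal.tendsto_toReal (measure_ne_top _ _)).comp
        (tendsto_measure_iInter_atTop (fun _ => MeasurableSet.nullMeasurableSet trivial) ?_
          ⟨0, measure_ne_top _ _⟩)
      intro a b hab
      refine Set.inter_subset_inter_right _ (Set.biInter_subset_biInter_left ?_)
      exact Finset.erase_subset_erase _ (Finset.Ico_subset_Ico_right hab)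
    have h1Q : (1 - Q n) ≠ 0 := by linarith [hQ1 n hn1]
    -- Erasing `n` divides the product over `Finset.Ico 1 m` by `1 - Q n`, so the limit is `Q n * z
    -- / (1 - Q n) = p n`.
    have hlim2 : Tendsto (fun m => μ.real (C n ∩ ⋂ j ∈ (Finset.Ico 1 m).erase n, (C j)ᶜ)) atTop
        (𝓝 (p n).toReal) := by
      have h2 := (ht.const_mul (Q n)).div_const (1 - Q n)
      rw [hz n h, mul_div_assoc, div_self h1Q, mul_one] at h2
      refine h2.congr' ?_
      filter_upwards [eventually_gt_atTop n] with m hm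
      rw [key n _ (by simp), ← Finset.mul_prod_erase (Finset.Ico 1 m) _
        (Finset.mem_Ico.2 ⟨hn1, hm⟩)]
      field_simp
    exact tendsto_nhds_unique hlim hlim2

/-! ### Cycles of cells and their first-order decoding -/

/-- An encoding of a sequence of instances by groups of facts of bounded arity: the `n`-th group
is a cycle of `len n` cells, each of which carries up to `slots` facts. -/
structure BlockCode (τ : Schema) (U : Type u) where
  /-- the number of classes of groups, minus one -/
  lastClass : ℕ
  /-- the number of facts carried by a cell -/
  slots : ℕ
  /-- a bound on the arities of the carried facts -/
  width : ℕ
  ar_le : ∀ R, τ.ar R ≤ width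
  /-- names for groups and positions -/
  name : ℕ → U
  name_injective : Function.Injective name
  /-- the class of a group -/
  cls : ℕ → Fin (lastClass + 1)
  cls_eq_last : ∀ n, cls n = Fin.last lastClass ↔ n = 0
  /-- the number of cells of a group -/
  len : ℕ → ℕ
  len_pos : ∀ n, 0 < len n
  /-- the facts carried by a cell -/
  payload : ℕ → ℕ → Fin slots → Option (Fact τ U)

namespace BlockCode

variable {τ : Schema} {U : Type u} (B : BlockCode τ U)

/-- The number of columns of a cell. -/
abbrev cols : ℕ := 3 + B.slots * B.width

/-- The schema of the cells. -/
@[reducible]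
def schema : Schema where
  Rel := Fin (B.lastClass + 1) × (Fin B.slots → Option τ.Rel)
  ar _ := B.cols
  finite_rel := inferInstance
  nonempty_rel := inferInstance

/-- The column with the name of the group. -/
def colGroup : Fin B.cols := Fin.castAdd _ 0

/-- The column with the name of the position. -/
def colPos : Fin B.cols := Fin.castAdd _ 1

/-- The column with the name of the next position. -/
def colNext : Fin B.cols := Fin.castAdd _ 2

/-- The columns with the arguments of the carried facts. -/
def colArg (k : Fin B.slots) (i : Fin B.width) : Fin B.cols := Fin.natAdd 3 (finProdFinEquiv (k, i))

/-- The arguments of a carried fact, padded. -/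
def arg (o : Option (Fact τ U)) (i : Fin B.width) : U :=
  match o with
  | some f => if h : (i : ℕ) < τ.ar f.1 then f.2 ⟨i, h⟩ else B.name 0
  | none => B.name 0

/-- The entries of a cell. -/
noncomputable def tuple (n j : ℕ) : Fin B.cols → U :=
  Fin.append ![B.name n, B.name j, B.name ((j + 1) % B.len n)] fun x =>
    B.arg (B.payload n j (finProdFinEquiv.symm x).1) (finProdFinEquiv.symm x).2

/-- The cell of group `n` at position `j`. -/
noncomputable def cell (n j : ℕ) : Fact B.schema U :=
  ⟨(B.cls n, fun k => (B.payload n j k).map Sigma.fst), B.tuple n j⟩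

@[simp] theorem tuple_colGroup (n j : ℕ) : B.tuple n j B.colGroup = B.name n := by
  simp [tuple, colGroup]

@[simp] theorem tuple_colPos (n j : ℕ) : B.tuple n j B.colPos = B.name j := by
  simp [tuple, colPos]

@[simp] theorem tuple_colNext (n j : ℕ) :
    B.tuple n j B.colNext = B.name ((j + 1) % B.len n) := by
  simp [tuple, colNext]

@[simp] theorem tuple_colArg (n j : ℕ) (k : Fin B.slots) (i : Fin B.width) :
    B.tuple n j (B.colArg k i) = B.arg (B.payload n j k) i := by
  rw [tuple, colArg, Fin.append_right, Equiv.symm_apply_apply]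

theorem cell_inj {n j n' j' : ℕ} (h : B.cell n j = B.cell n' j') : n = n' ∧ j = j' := by
  have h2 : B.tuple n j = B.tuple n' j' := by
    rw [cell, cell, Sigma.mk.injEq] at h
    exact eq_of_heq h.2
  constructor
  · simpa [B.name_injective.eq_iff] using congrFun h2 B.colGroup
  · simpa [B.name_injective.eq_iff] using congrFun h2 B.colPos

/-- A carried fact can be recovered from its cell: its symbol is part of the cell's relation symbol,
its arguments stand in fixed columns, and the padding is never read. -/
theorem payload_eq_some_iff (n j : ℕ) (k : Fin B.slots) (f : Fact τ U) :
    B.payload n j k = some f ↔ (B.payload n j k).map Sigma.fst = some f.1 ∧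
      ∀ i, f.2 i = B.tuple n j (B.colArg k (Fin.castLE (B.ar_le f.1) i)) := by
  simp only [tuple_colArg]
  rcases h : B.payload n j k with _ | ⟨R, a⟩
  · simp
  · obtain ⟨R', a'⟩ := f
    simp only [Option.some.injEq, Option.map_some, arg]
    constructor
    · intro h'
      cases h'
      simp
    · rintro ⟨rfl, h'⟩
      congr 1
      funext i
      simpa using (h' i).symm

/-- The fact with the given class, carried symbols and entries. -/
def mkFact (b : Fin (B.lastClass + 1)) (ρ : Fin B.slots → Option τ.Rel) (w : Fin B.cols → U) :
    Fact B.schema U := ⟨(b, ρ), w⟩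

/-- The present cells of the group named `a` in class `b` are closed under successors. -/
def Closed (b : Fin (B.lastClass + 1)) (D : Inst B.schema U) (a : U) : Prop :=
  ∀ ρ w, B.mkFact b ρ w ∈ D → w B.colGroup = a →
    ∃ ρ' w', B.mkFact b ρ' w' ∈ D ∧ w' B.colGroup = a ∧ w' B.colPos = w B.colNext

/-- The group named `a` in class `b` is the one complete group of smallest class. -/
def Best (b : Fin (B.lastClass + 1)) (D : Inst B.schema U) (a : U) : Prop :=
  B.Closed b D a ∧ ∀ b', b' ≤ b → ∀ ρ w, B.mkFact b' ρ w ∈ D →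
    B.Closed b' D (w B.colGroup) → w B.colGroup = a

/-- The group named `a` in class `b` is the one to be decoded. -/
def Chosen (b : Fin (B.lastClass + 1)) (D : Inst B.schema U) (a : U) : Prop :=
  B.Best b D a ∨ (b = Fin.last _ ∧
    ¬ ∃ b' ρ w, B.mkFact b' ρ w ∈ D ∧ B.Best b' D (w B.colGroup))

/-- The facts to be decoded. -/
def Decoded (R : τ.Rel) (D : Inst B.schema U) (v : Fin (τ.ar R) → U) : Prop :=
  ∃ (b : _) (ρ : Fin B.slots → Option τ.Rel) (k : _), ρ k = some R ∧ ∃ w, B.mkFact b ρ w ∈ D ∧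
    B.Chosen b D (w B.colGroup) ∧ ∀ i, v i = w (B.colArg k (Fin.castLE (B.ar_le R) i))

theorem definable_exists_fact {n : ℕ} (b ρ)
    {P : Inst B.schema U → (Fin (n + B.cols) → U) → Prop} (hP : Definable P) :
    Definable fun D v => ∃ w, B.mkFact b ρ w ∈ D ∧ P D (Fin.append v w) :=
  Definable.exists_fact (σ := B.schema) (b, ρ) hP

theorem definable_forall_fact {n : ℕ} (b ρ)
    {P : Inst B.schema U → (Fin (n + B.cols) → U) → Prop} (hP : Definable P) :
    Definable fun D v => ∀ w, B.mkFact b ρ w ∈ D → P D (Fin.append v w) :=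
  Definable.forall_fact (σ := B.schema) (b, ρ) hP

theorem definable_closed (b) {n : ℕ} (x : Fin n) :
    Definable fun (D : Inst B.schema U) v => B.Closed b D (v x) := by
  refine (Definable.forall_finite fun ρ => B.definable_forall_fact b ρ <|
    (Definable.eq (Fin.natAdd n B.colGroup) (Fin.castAdd _ x)).imp <|
    Definable.exists_finite fun ρ' => B.definable_exists_fact b ρ' <|
    (Definable.eq (Fin.natAdd _ B.colGroup) (Fin.castAdd _ (Fin.castAdd _ x))).and
    (Definable.eq (Fin.natAdd _ B.colPos) (Fin.castAdd _ (Fin.natAdd _ B.colNext)))).congr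
    fun D v => ?_
  simp only [Fin.append_left, Fin.append_right]
  rfl

theorem definable_best (b) {n : ℕ} (x : Fin n) :
    Definable fun (D : Inst B.schema U) v => B.Best b D (v x) := by
  refine ((B.definable_closed b x).and <| Definable.forall_finite fun b' =>
    (Definable.const (b' ≤ b)).imp <| Definable.forall_finite fun ρ =>
    B.definable_forall_fact b' ρ <| (B.definable_closed b' (Fin.natAdd n B.colGroup)).imp
    (Definable.eq (Fin.natAdd n B.colGroup) (Fin.castAdd _ x))).congr fun D v => ?_
  simp only [Fin.append_left, Fin.append_right]
  rfl

theorem definable_chosen (b) {n : ℕ} (x : Fin n) :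
    Definable fun (D : Inst B.schema U) v => B.Chosen b D (v x) := by
  refine ((B.definable_best b x).or <| (Definable.const (b = Fin.last _)).and <|
    Definable.not <| Definable.exists_finite fun b' => Definable.exists_finite fun ρ =>
    B.definable_exists_fact b' ρ <| B.definable_best b' (Fin.natAdd n B.colGroup)).congr
    fun D v => ?_
  simp only [Fin.append_right]
  rfl

theorem definable_decoded (R : τ.Rel) :
    Definable fun (D : Inst B.schema U) (v : Fin (τ.ar R) → U) => B.Decoded R D v := by
  refine (Definable.exists_finite fun b => Definable.exists_finite fun ρ =>
    Definable.exists_finite fun k => (Definable.const (ρ k = some R)).and <|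
    B.definable_exists_fact b ρ <| (B.definable_chosen b (Fin.natAdd _ B.colGroup)).and <|
    Definable.forall_finite fun i => Definable.eq (Fin.castAdd _ i)
      (Fin.natAdd _ (B.colArg k (Fin.castLE (B.ar_le R) i)))).congr fun D v => ?_
  simp only [Fin.append_left, Fin.append_right]
  rfl

theorem exists_decoding_view :
    ∃ V : FOView B.schema τ U, ∀ D f, f ∈ V.apply D ↔ B.Decoded f.1 D f.2 := by
  refine exists_view B.definable_decoded ?_
  rintro R D v ⟨b, ρ, k, -, w, hw, -, hv⟩ i
  exact ⟨_, hw, B.colArg k (Fin.castLE (B.ar_le R) i), (hv i).symm⟩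

/-- The complete groups of an instance. -/
def complete (I : Inst B.schema U) : Set ℕ := {n | ∀ j < B.len n, B.cell n j ∈ I}

variable {B} {I : Inst B.schema U} (hI : ∀ f ∈ I, ∃ n, ∃ j < B.len n, f = B.cell n j)
include hI

theorem exists_of_mkFact_mem {b ρ w} (h : B.mkFact b ρ w ∈ I) :
    ∃ n, ∃ j < B.len n, B.cell n j ∈ I ∧ b = B.cls n ∧
      (ρ = fun k => (B.payload n j k).map Sigma.fst) ∧ w = B.tuple n j := by
  obtain ⟨n, j, hj, he⟩ := hI _ h
  refine ⟨n, j, hj, he ▸ h, ?_⟩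
  rw [mkFact, cell, Sigma.mk.injEq, Prod.mk.injEq] at he
  exact ⟨he.1.1, he.1.2, eq_of_heq he.2⟩

/-- From one present cell, following successors around the cycle reaches every position. The
hypothesis `h` excludes an empty group, which would be vacuously closed. -/
theorem closed_iff {n j : ℕ} (hj : j < B.len n) (h : B.cell n j ∈ I) :
    B.Closed (B.cls n) I (B.name n) ↔ n ∈ B.complete I := by
  constructor
  · intro hc
    have step : ∀ i, B.cell n i ∈ I → B.cell n ((i + 1) % B.len n) ∈ I := by
      intro i hi
      obtain ⟨ρ', w', h1, h2, h3⟩ := hc _ (B.tuple n i) hi (by simp)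
      obtain ⟨n', j', -, h4, -, -, rfl⟩ := exists_of_mkFact_mem hI h1
      simp only [tuple_colGroup, tuple_colPos, tuple_colNext, B.name_injective.eq_iff] at h2 h3
      rwa [h2, h3] at h4
    have iter : ∀ k, B.cell n ((j + k) % B.len n) ∈ I := by
      intro k
      induction k with
      | zero => rwa [add_zero, Nat.mod_eq_of_lt hj]
      | succ k ih =>
        have := step _ ih
        rwa [Nat.mod_add_mod, add_assoc] at this
    intro i hi
    -- This many steps from position `j` wrap once around the cycle and end at `i`.
    have := iter (B.len n - j + i)
    rwa [show j + (B.len n - j + i) = i + B.len n by omega, Nat.add_mod_right,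
      Nat.mod_eq_of_lt hi] at this
  · intro hn ρ w hw hg
    obtain ⟨n', i, hi, -, -, -, rfl⟩ := exists_of_mkFact_mem hI hw
    simp only [tuple_colGroup, B.name_injective.eq_iff] at hg
    subst hg
    exact ⟨_, _, hn _ (Nat.mod_lt (i + 1) (B.len_pos n')), by simp, by simp⟩

theorem best_iff {n j : ℕ} (hj : j < B.len n) (h : B.cell n j ∈ I) :
    B.Best (B.cls n) I (B.name n) ↔ IsSelected (fun n => B.cls n) (B.complete I) n := by
  rw [Best, IsSelected, closed_iff hI hj h]
  refine and_congr_right fun _ => ?_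
  constructor
  · intro h1 i hi hne
    by_contra hlt
    have h2 := h1 (B.cls i) (by simpa using hlt) _ (B.tuple i 0) (hi 0 (B.len_pos i))
    rw [tuple_colGroup, closed_iff hI (B.len_pos i) (hi 0 (B.len_pos i)),
      B.name_injective.eq_iff] at h2
    exact hne (h2 hi)
  · intro h1 b' hb' ρ w hw hc
    obtain ⟨i, j', hj', hi, rfl, -, rfl⟩ := exists_of_mkFact_mem hI hw
    rw [tuple_colGroup] at hc ⊢
    rw [closed_iff hI hj' hi] at hc
    by_contra hne
    have := h1 i hc fun h => hne (h ▸ rfl)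
    exact absurd hb' (not_le.2 this)

/-- The fallback clause of `Chosen` matches the default value of `select`, because group `0` is
alone in the last class. -/
theorem chosen_iff {n j : ℕ} (hj : j < B.len n) (h : B.cell n j ∈ I) :
    B.Chosen (B.cls n) I (B.name n) ↔ select (fun n => B.cls n) (B.complete I) = n := by
  have hex : (∃ b' ρ w, B.mkFact b' ρ w ∈ I ∧ B.Best b' I (w B.colGroup)) ↔
      ∃ i, IsSelected (fun n => B.cls n) (B.complete I) i := by
    constructor
    · rintro ⟨b', ρ, w, hw, hb⟩
      obtain ⟨i, j', hj', hi, rfl, -, rfl⟩ := exists_of_mkFact_mem hI hw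
      rw [tuple_colGroup, best_iff hI hj' hi] at hb
      exact ⟨i, hb⟩
    · rintro ⟨i, hi⟩
      have h0 := hi.1 0 (B.len_pos i)
      exact ⟨_, _, _, h0, by rwa [tuple_colGroup, best_iff hI (B.len_pos i) h0]⟩
  rw [Chosen, best_iff hI hj h, hex, B.cls_eq_last]
  by_cases hs : ∃ i, IsSelected (fun n => (B.cls n : ℕ)) (B.complete I) i
  · simp only [hs, not_true, and_false, or_false]
    obtain ⟨i, hi⟩ := hs
    rw [hi.select_eq]
    exact ⟨fun h => hi.unique h, fun h => h ▸ hi⟩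
  · rw [select_eq_zero hs]
    simp only [hs, not_false_eq_true, and_true]
    constructor
    · rintro (h | h)
      · exact absurd ⟨n, h⟩ hs
      · exact h.symm
    · exact fun h => Or.inr h.symm

/-- Completeness of group `0` ensures that the selected group is complete even in the fallback case,
so its whole payload can be read off. -/
theorem decoded_iff (h0 : 0 ∈ B.complete I) (f : Fact τ U) :
    B.Decoded f.1 I f.2 ↔ ∃ j < B.len (select (fun n => B.cls n) (B.complete I)), ∃ k,
      B.payload (select (fun n => B.cls n) (B.complete I)) j k = some f := by
  constructor
  · rintro ⟨b, ρ, k, hρ, w, hw, hc, hv⟩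
    obtain ⟨n, j, hj, h, rfl, rfl, rfl⟩ := exists_of_mkFact_mem hI hw
    rw [tuple_colGroup, chosen_iff hI hj h] at hc
    subst hc
    exact ⟨j, hj, k, (B.payload_eq_some_iff _ _ _ _).2 ⟨hρ, hv⟩⟩
  · rintro ⟨j, hj, k, hk⟩
    have hmem : select (fun n => (B.cls n : ℕ)) (B.complete I) ∈ B.complete I := by
      by_cases hs : ∃ i, IsSelected (fun n => (B.cls n : ℕ)) (B.complete I) i
      · obtain ⟨i, hi⟩ := hs
        rw [hi.select_eq]
        exact hi.1
      · rwa [select_eq_zero hs]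
    have hk' := (B.payload_eq_some_iff _ _ _ _).1 hk
    exact ⟨_, _, k, hk'.1, _, hmem j hj, by
      rw [tuple_colGroup, chosen_iff hI hj (hmem j hj)], hk'.2⟩

end BlockCode

/-! ### The sufficient criterion for membership -/

theorem pmf_map_congr {α β : Type*} (p : PMF α) {f g : α → β} (h : ∀ a ∈ p.support, f a = g a) :
    p.map f = p.map g := by
  refine PMF.toOuterMeasure_injective (DFunLike.ext _ _ fun s => ?_)
  rw [PMF.toOuterMeasure_map_apply, PMF.toOuterMeasure_map_apply]
  refine PMF.toOuterMeasure_apply_eq_of_inter_support_eq _ ?_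
  ext a
  simp only [Set.mem_inter_iff, Set.mem_preimage]
  exact and_congr_left fun ha => by rw [h a ha]

theorem PDB.isImage_of_map_eq {σ τ : Schema} {U : Type u} {V : FOView σ τ U} {𝓘 : PDB σ U}
    {𝓓 : PDB τ U} (hs : 𝓘.space ⊆ 𝓘.prob.support) (h : 𝓘.prob.map V.apply = 𝓓.prob) :
    PDB.IsImage V 𝓘 𝓓 := by
  constructor
  · intro I hI
    apply 𝓓.support_subset
    rw [← h, PMF.mem_support_map_iff]
    exact ⟨I, hs hI, rfl⟩
  · intro D' _
    rw [← h, ← PMF.toOuterMeasure_apply_singleton, PMF.toOuterMeasure_map_apply, PDB.Pr]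
    refine PMF.toOuterMeasure_apply_eq_of_inter_support_eq _ ?_
    ext I
    simp only [Set.mem_inter_iff, Set.mem_preimage, Set.mem_singleton_iff, Set.mem_ofPred_eq]
    exact ⟨fun h => ⟨⟨𝓘.support_subset h.2, h.1⟩, h.2⟩, fun h => ⟨h.1.2, h.2⟩⟩

theorem PDB.mem_facts_of_prob_map {σ : Schema} {U : Type u} {E : Type*} {e : E ↪ Fact σ U}
    {P : PMF (Finset E)} {𝓘 : PDB σ U} (h : 𝓘.prob = P.map (Finset.map e)) {f : Fact σ U}
    (hf : f ∈ 𝓘.facts) : f ∈ Set.range e := by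
  obtain ⟨D, ⟨-, hD⟩, hfD⟩ := hf
  rw [PMF.apply_pos_iff, h, PMF.mem_support_map_iff] at hD
  obtain ⟨J, -, rfl⟩ := hD
  obtain ⟨x, -, rfl⟩ := Finset.mem_map.1 hfD
  exact ⟨x, rfl⟩

theorem PDB.isTI_of_prob_map {σ : Schema} {U : Type u} {E : Type*} {e : E ↪ Fact σ U}
    {P : PMF (Finset E)} {q : E → ℝ≥0∞}
    (hP : ∀ S : Finset E, P.toOuterMeasure {J | ∀ x ∈ S, x ∈ J} = ∏ x ∈ S, q x)
    {𝓘 : PDB σ U} (h : 𝓘.prob = P.map (Finset.map e)) : 𝓘.IsTI := by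
  classical
  have key : ∀ T : Finset E, 𝓘.Pr {I | ∀ f ∈ T.map e, f ∈ I} = ∏ x ∈ T, q x := by
    intro T
    rw [PDB.Pr, h, PMF.toOuterMeasure_map_apply, ← hP T]
    congr 1
    ext J
    simp
  intro S hS
  obtain ⟨T, rfl⟩ : ∃ T : Finset E, S = T.map e := by
    refine ⟨S.preimage e e.injective.injOn, ?_⟩
    ext f
    simp only [Finset.mem_map, Finset.mem_preimage]
    constructor
    · intro hf
      obtain ⟨x, rfl⟩ := PDB.mem_facts_of_prob_map h (hS hf)
      exact ⟨x, hf, rfl⟩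
    · rintro ⟨x, hx, rfl⟩
      exact hx
  rw [key, Finset.prod_map]
  refine Finset.prod_congr rfl fun x _ => ?_
  have := key {x}
  simpa using this.symm

/-- A sufficient criterion: the worlds split into groups of cells such that the probability of
a world is at most `s ^ len`, where `∑ len * s` converges. -/
theorem PDB.inFOTI_of_summable {τ : Schema} {U : Type u} [Infinite U] (𝓓 : PDB τ U)
    (p : PMF ℕ) (D : ℕ → Inst τ U) (hp0 : p 0 ≠ 0) (hD : p.map D = 𝓓.prob) (K : ℕ)
    (len : ℕ → ℕ) (hlen : ∀ n, 0 < len n) (payload : ℕ → ℕ → Fin K → Option (Fact τ U))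
    (hpay : ∀ n, p n ≠ 0 → ∀ f, f ∈ D n ↔ ∃ j < len n, ∃ k, payload n j k = some f)
    (s : ℕ → ℝ) (hs0 : ∀ n, 0 ≤ s n) (hps : ∀ n, (p n).toReal ≤ s n ^ len n)
    (hsum : Summable fun n => len n * s n) : 𝓓.InFOTI := by
  classical
  have hpsum : HasSum (fun n => (p n).toReal) 1 := by
    have h := ENNReal.hasSum_toReal p.tsum_coe_ne_top
    rwa [← ENNReal.tsum_toReal_eq p.apply_ne_top, p.tsum_coe, ENNReal.toReal_one] at h
  obtain ⟨N, Q, C, z, hN, hC, hQ0, hQn, hQ1, hQC, hQs, hQt, hQz⟩ :=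
    exists_activation (fun n => ENNReal.toReal_nonneg)
      (ENNReal.toReal_pos hp0 (p.apply_ne_top 0)) hpsum
  obtain ⟨w, hw⟩ : ∃ w, ∀ R, τ.ar R ≤ w :=
    ⟨_, fun R => le_ciSup (Set.finite_range τ.ar).bddAbove R⟩
  let B : BlockCode τ U :=
    { lastClass := N + 1
      slots := K
      width := w
      ar_le := hw
      name := Infinite.natEmbedding U
      name_injective := (Infinite.natEmbedding U).injective
      cls := fun n => ⟨indexClass N n, Nat.lt_succ_of_le (indexClass_le N n)⟩
      cls_eq_last := fun n => by
        simp only [Fin.ext_iff, Fin.val_last]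
        unfold indexClass
        split_ifs with h
        · simp [h]
        · simp only [h, iff_false]
          omega
      len := len
      len_pos := hlen
      payload := payload }
  obtain ⟨V, hV⟩ := B.exists_decoding_view
  have hQle : ∀ n, Q n ≤ 1 := fun n => by
    rcases Nat.eq_zero_or_pos n with rfl | h
    · exact hQ0.le
    · exact (hQ1 n h).le
  have hroot : ∀ n, ∃ r : ℝ, 0 ≤ r ∧ r ^ len n = Q n := fun n =>
    ⟨Q n ^ ((len n : ℝ)⁻¹), Real.rpow_nonneg (hQn n) _,
      Real.rpow_inv_natCast_pow (hQn n) (hlen n).ne'⟩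
  choose r hr0 hr using hroot
  have hr1 : ∀ n, r n ≤ 1 := fun n => by
    rw [← pow_le_one_iff_of_nonneg (hr0 n) (hlen n).ne', hr]
    exact hQle n
  -- Since `1 ≤ C` and `len n` is positive, `C ≤ C ^ len n`, so the constant can be moved under the
  -- root.
  have hrs : ∀ n, r n ≤ C * s n := fun n => by
    rw [← pow_le_pow_iff_left₀ (hr0 n) (mul_nonneg (by linarith) (hs0 n)) (hlen n).ne', hr, mul_pow]
    calc Q n ≤ C * (p n).toReal := hQC n
      _ ≤ C ^ len n * s n ^ len n :=
        mul_le_mul (le_self_pow₀ hC (hlen n).ne') (hps n) ENNReal.toReal_nonneg (by positivity)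
  let q : (Σ n, Fin (len n)) → ℝ≥0∞ := fun x => ENNReal.ofReal (r x.1)
  have hq : ∑' x, q x ≠ ∞ := by
    have h1 : ∑' x, q x ≤ ∑' n, ENNReal.ofReal (C * (len n * s n)) := by
      rw [ENNReal.tsum_sigma']
      refine ENNReal.tsum_le_tsum fun n => ?_
      rw [tsum_fintype]
      simp only [q, Finset.sum_const, Finset.card_univ, Fintype.card_fin, nsmul_eq_mul]
      rw [← ENNReal.ofReal_natCast, ← ENNReal.ofReal_mul (Nat.cast_nonneg _)]
      refine ENNReal.ofReal_le_ofReal ?_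
      have := mul_le_mul_of_nonneg_left (hrs n) (Nat.cast_nonneg (α := ℝ) (len n))
      linarith
    exact ne_top_of_le_ne_top (hsum.mul_left C).tsum_ofReal_ne_top h1
  obtain ⟨P, hP⟩ := exists_independent_finset q
    (fun x => by simpa [q] using hr1 x.1) hq
  let e : (Σ n, Fin (len n)) ↪ Fact B.schema U :=
    ⟨fun x => B.cell x.1 x.2, fun x y h => by
      obtain ⟨h1, h2⟩ := B.cell_inj h
      exact Sigma.ext h1 ((Fin.heq_ext_iff (by rw [h1])).2 h2)⟩
  let 𝓘 : PDB B.schema U :=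
    { space := (P.map (Finset.map e)).support
      countable_space := PMF.support_countable _
      prob := P.map (Finset.map e)
      support_subset := subset_rfl }
  have hcomp : ∀ (J : Finset (Σ n, Fin (len n))) (n : ℕ),
      n ∈ B.complete (J.map e) ↔ ∀ j, (⟨n, j⟩ : Σ n, Fin (len n)) ∈ J := by
    intro J n
    constructor
    · intro h j
      exact (Finset.mem_map' e).1 (h j j.2)
    · intro h j hj
      exact (Finset.mem_map' e).2 (h ⟨j, hj⟩)
  -- Distinct groups have disjoint sets of cells, so completeness inherits independence, with
  -- probability `r n ^ len n = Q n`.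
  have hind : ∀ S : Finset ℕ, P.toOuterMeasure {J | ∀ n ∈ S, n ∈ B.complete (J.map e)} =
      ∏ n ∈ S, ENNReal.ofReal (Q n) := by
    intro S
    have h1 := hP (S.sigma fun n => Finset.univ)
    rw [Finset.prod_sigma] at h1
    have h2 : ∀ n, ∏ j : Fin (len n), q ⟨n, j⟩ = ENNReal.ofReal (Q n) := by
      intro n
      simp only [q, Finset.prod_const, Finset.card_univ, Fintype.card_fin]
      rw [← ENNReal.ofReal_pow (hr0 n), hr]
    simp only [h2] at h1
    rw [← h1]
    congr 1
    ext J
    simp only [hcomp, Set.mem_ofPred_eq, Finset.mem_sigma, Finset.mem_univ, and_true]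
    exact ⟨fun h x hx => h x.1 hx x.2, fun h n hn j => h ⟨n, j⟩ hn⟩
  have hsel := map_select_eq P (fun J => B.complete (J.map e)) p hN hQn hQ1 hQs hQt hQz hind
  have hzero : ∀ J ∈ P.support, 0 ∈ B.complete (J.map e) := by
    have h := hind {0}
    simp only [Finset.mem_singleton, forall_eq, Finset.prod_singleton, hQ0, ENNReal.ofReal_one] at h
    exact (PMF.toOuterMeasure_apply_eq_one_iff _ _).1 h
  refine ⟨B.schema, 𝓘, V, PDB.isTI_of_prob_map hP rfl, PDB.isImage_of_map_eq subset_rfl ?_⟩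
  change (P.map (Finset.map e)).map V.apply = 𝓓.prob
  rw [← hD, ← hsel, PMF.map_comp, PMF.map_comp]
  refine pmf_map_congr P fun J hJ => ?_
  -- `hpay` describes only indices of positive probability; almost surely the selected one has this
  -- property because its law is `p`.
  have hpn : p (select (indexClass N) (B.complete (J.map e))) ≠ 0 := by
    rw [← PMF.mem_support_iff, ← hsel, PMF.mem_support_map_iff]
    exact ⟨J, hJ, rfl⟩
  ext f
  simp only [Function.comp]
  rw [hV, hpay _ hpn]
  refine BlockCode.decoded_iff ?_ (hzero J hJ) f
  intro g hg
  obtain ⟨x, -, rfl⟩ := Finset.mem_map.1 hg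
  exact ⟨x.1, x.2, x.2.2, rfl⟩

/-! ### Finite expected size as a necessary condition -/

section

/-- Over the subsets of a finite set the sum is `∏ (1 + p f)`, which is at most `exp (∑ p f)`. -/
theorem tsum_finset_prod_ne_top {F : Type*} {p : F → ℝ≥0∞} (hp : ∑' f, p f ≠ ∞) :
    ∑' S : Finset F, ∏ f ∈ S, p f ≠ ∞ := by
  classical
  have hpf : ∀ f, p f ≠ ∞ := fun f => ENNReal.ne_top_of_tsum_ne_top hp f
  refine ne_top_of_le_ne_top (ENNReal.ofReal_ne_top (r := Real.exp (∑' f, p f).toReal)) ?_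
  rw [ENNReal.tsum_eq_iSup_sum]
  refine iSup_le fun 𝒮 => ?_
  calc ∑ S ∈ 𝒮, ∏ f ∈ S, p f ≤ ∑ S ∈ (𝒮.sup id).powerset, ∏ f ∈ S, p f :=
        Finset.sum_le_sum_of_subset fun S hS => Finset.mem_powerset.2 (Finset.le_sup (f := id) hS)
    _ = ∏ f ∈ 𝒮.sup id, (1 + p f) := (Finset.prod_one_add _).symm
    _ ≤ ∏ f ∈ 𝒮.sup id, ENNReal.ofReal (Real.exp (p f).toReal) := by
        refine Finset.prod_le_prod' fun f _ => ?_
        rw [← ENNReal.ofReal_toReal (hpf f), ← ENNReal.ofReal_one,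
          ← ENNReal.ofReal_add zero_le_one ENNReal.toReal_nonneg,
          ENNReal.toReal_ofReal ENNReal.toReal_nonneg]
        refine ENNReal.ofReal_le_ofReal ?_
        linarith [Real.add_one_le_exp (p f).toReal]
    _ = ENNReal.ofReal (Real.exp (∑ f ∈ 𝒮.sup id, p f).toReal) := by
        rw [← ENNReal.ofReal_prod_of_nonneg fun _ _ => (Real.exp_pos _).le, ← Real.exp_sum,
          ENNReal.toReal_sum fun f _ => hpf f]
    _ ≤ _ := by
        refine ENNReal.ofReal_le_ofReal (Real.exp_le_exp.2 (ENNReal.toReal_mono hp ?_))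
        exact ENNReal.sum_le_tsum _

variable {σ τ : Schema} {U : Type u}

theorem PDB.Pr_eq_zero_of_notMem_facts {𝓘 : PDB σ U} {f : Fact σ U} (hf : f ∉ 𝓘.facts)
    {E : Set (Inst σ U)} (hE : ∀ I ∈ E, f ∈ I) : 𝓘.Pr E = 0 := by
  rw [PDB.Pr, PMF.toOuterMeasure_apply_eq_zero_iff, Set.disjoint_left]
  intro I hI hIE
  exact hf ⟨I, ⟨𝓘.support_subset hI, (PMF.apply_pos_iff _ _).2 hI⟩, hE I hIE⟩

/-- A fact that occurs in no world makes both sides zero, so the restriction to `𝓘.facts` can be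
dropped. -/
theorem PDB.IsTI.Pr_eq_prod {𝓘 : PDB σ U} (h : 𝓘.IsTI) (S : Finset (Fact σ U)) :
    𝓘.Pr {I | ∀ f ∈ S, f ∈ I} = ∏ f ∈ S, 𝓘.Pr {I | f ∈ I} := by
  by_cases hS : (S : Set (Fact σ U)) ⊆ 𝓘.facts
  · exact h S hS
  · obtain ⟨f, hfS, hf⟩ := Set.not_subset.1 hS
    have h0 : 𝓘.Pr {I | ∀ f ∈ S, f ∈ I} = 0 :=
      PDB.Pr_eq_zero_of_notMem_facts hf fun I (hI : ∀ f ∈ S, f ∈ I) => hI f hfS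
    rw [h0]
    exact (Finset.prod_eq_zero hfS (PDB.Pr_eq_zero_of_notMem_facts hf fun I hI => hI)).symm

/-- The marginal probabilities of a tuple-independent PDB have a finite sum. -/
theorem PDB.IsTI.tsum_Pr_ne_top [Countable U] {𝓘 : PDB σ U} (h : 𝓘.IsTI) :
    ∑' f : Fact σ U, 𝓘.Pr {I | f ∈ I} ≠ ∞ := by
  classical
  rcases finite_or_infinite (Fact σ U) with hfin | hinf
  · cases nonempty_fintype (Fact σ U)
    rw [tsum_fintype]
    refine ENNReal.sum_ne_top.2 fun f _ => ?_
    rw [PDB.Pr, PMF.toOuterMeasure_apply]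
    exact 𝓘.prob.tsum_coe_indicator_ne_top _
  · obtain ⟨d⟩ := nonempty_denumerable (Fact σ U)
    let e : ℕ ≃ Fact σ U := (Denumerable.eqv (Fact σ U)).symm
    let _ : MeasurableSpace (Inst σ U) := ⊤
    let μ : Measure (Inst σ U) := 𝓘.prob.toMeasure
    have hμ : ∀ A, μ A = 𝓘.Pr A := fun A =>
      𝓘.prob.toMeasure_apply_eq_toOuterMeasure_apply trivial
    let s : ℕ → Set (Inst σ U) := fun n => {I | e n ∈ I}
    have hs : iIndepSet s μ := by
      rw [iIndepSet_iff_meas_biInter fun n => show MeasurableSet (s n) from trivial]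
      intro S
      have h1 := h.Pr_eq_prod (S.map e.toEmbedding)
      rw [Finset.prod_map] at h1
      simp only [hμ]
      refine Eq.trans ?_ h1
      congr 1
      ext I
      simp only [s, Set.mem_iInter, Set.mem_ofPred_eq, Finset.forall_mem_map, Equiv.coe_toEmbedding]
    intro htop
    -- Second Borel–Cantelli lemma: if the sum diverged, infinitely many facts would almost surely
    -- hold at once, but instances are finite.
    have h1 := measure_limsup_eq_one (fun n => show MeasurableSet (s n) from trivial) hs (by
      rw [← htop, ← e.tsum_eq fun f => 𝓘.Pr {I | f ∈ I}]
      exact tsum_congr fun n => hμ _)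
    rw [← Nat.cofinite_eq_atTop, Filter.cofinite.limsup_set_eq] at h1
    have h2 : {I : Inst σ U | {n | I ∈ s n}.Infinite} = ∅ := by
      ext I
      simp only [Set.mem_ofPred_eq, Set.mem_empty_iff_false, iff_false, Set.not_infinite]
      exact (I.finite_toSet.preimage e.injective.injOn)
    rw [h2, measure_empty] at h1
    exact zero_ne_one h1

/-- The size of a tuple-independent PDB has an exponential moment. -/
theorem PDB.IsTI.tsum_two_pow_card_ne_top [Countable U] {𝓘 : PDB σ U} (h : 𝓘.IsTI) :
    ∑' I, 𝓘.prob I * 2 ^ I.card ≠ ∞ := by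
  classical
  refine ne_of_eq_of_ne ?_ (tsum_finset_prod_ne_top h.tsum_Pr_ne_top)
  -- `2 ^ I.card` counts the subsets of `I`; exchanging the sums turns the moment into `∑_S Pr(S ⊆
  -- I)`.
  have h1 : ∀ I : Inst σ U, 𝓘.prob I * 2 ^ I.card =
      ∑' S : Finset (Fact σ U), if S ⊆ I then 𝓘.prob I else 0 := by
    intro I
    rw [tsum_eq_sum (s := I.powerset) fun S hS => if_neg (by simpa using hS),
      Finset.sum_congr rfl fun S hS => if_pos (Finset.mem_powerset.1 hS)]
    simp [mul_comm]
  simp_rw [h1]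
  rw [ENNReal.tsum_comm]
  refine tsum_congr fun S => ?_
  rw [← h.Pr_eq_prod, PDB.Pr, PMF.toOuterMeasure_apply]
  refine tsum_congr fun I => ?_
  simp only [Set.indicator_apply, Set.mem_ofPred_eq, Finset.subset_iff]

theorem exists_linear_pow_le (m k a : ℕ) : ∃ C : ℕ, ∀ n : ℕ, (m * n + k) ^ a ≤ C * 2 ^ n := by
  obtain ⟨B, hB⟩ := (tendsto_pow_const_div_const_pow_of_one_lt a (one_lt_two (α := ℝ))).bddAbove_range
  obtain ⟨C, hC⟩ := exists_nat_ge (B * 2)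
  refine ⟨(m + k) ^ a * C, fun n => ?_⟩
  have h1 : ((n + 1 : ℕ) : ℝ) ^ a / 2 ^ (n + 1) ≤ B := hB ⟨n + 1, rfl⟩
  rw [div_le_iff₀ (by positivity)] at h1
  have h2 : (n + 1) ^ a ≤ C * 2 ^ n := by
    have : ((n + 1 : ℕ) : ℝ) ^ a ≤ C * 2 ^ n := by
      refine h1.trans ?_
      rw [pow_succ']
      nlinarith [pow_pos (two_pos (α := ℝ)) n]
    exact_mod_cast this
  calc (m * n + k) ^ a ≤ ((m + k) * (n + 1)) ^ a := Nat.pow_le_pow_left (by nlinarith) a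
    _ = (m + k) ^ a * (n + 1) ^ a := mul_pow _ _ _
    _ ≤ (m + k) ^ a * (C * 2 ^ n) := Nat.mul_le_mul_left _ h2
    _ = _ := (mul_assoc _ _ _).symm

/-- The output of a view has size at most a polynomial in the size of the input, hence at most
a constant times an exponential. -/
theorem FOView.exists_card_apply_le (V : FOView σ τ U) :
    ∃ C : ℕ, ∀ I, (V.apply I).card ≤ C * 2 ^ I.card := by
  classical
  cases nonempty_fintype τ.Rel
  obtain ⟨m, hm⟩ : ∃ m, ∀ R, σ.ar R ≤ m :=
    ⟨_, fun R => le_ciSup (Set.finite_range σ.ar).bddAbove R⟩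
  let c : (R : τ.Rel) → Finset U := fun R => (V R).consts_finite.toFinset
  choose C hC using fun R : τ.Rel => exists_linear_pow_le m (c R).card (τ.ar R)
  refine ⟨∑ R, C R, fun I => ?_⟩
  let A : τ.Rel → Finset U := fun R => (I.biUnion fun f => Finset.univ.image f.2) ∪ c R
  have hA : ∀ R, (A R).card ≤ m * I.card + (c R).card := by
    intro R
    refine (Finset.card_union_le _ _).trans (Nat.add_le_add_right ?_ _)
    rw [mul_comm]
    refine Finset.card_biUnion_le_card_mul _ _ _ fun f _ => Finset.card_image_le.trans ?_
    simpa using hm f.1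
  -- Answer entries come from the active domain and the constants, at most `m * I.card + (c R).card`
  -- elements.
  have hsub : V.apply I ⊆ Finset.univ.sigma fun R => Fintype.piFinset fun _ => A R := by
    rintro ⟨R, a⟩ hf
    rw [FOView.mem_apply] at hf
    simp only [Finset.mem_sigma, Finset.mem_univ, true_and, Fintype.mem_piFinset]
    intro i
    rcases hf.1 i with ⟨f, hfI, j, hj⟩ | h
    · exact Finset.mem_union_left _ (Finset.mem_biUnion.2
        ⟨f, hfI, Finset.mem_image.2 ⟨j, Finset.mem_univ _, hj⟩⟩)
    · exact Finset.mem_union_right _ ((Set.Finite.mem_toFinset _).2 h)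
  calc (V.apply I).card ≤ _ := Finset.card_le_card hsub
    _ = ∑ R, (A R).card ^ τ.ar R := by
      rw [Finset.card_sigma]
      refine Finset.sum_congr rfl fun R _ => ?_
      rw [Fintype.card_piFinset_const]
    _ ≤ ∑ R, C R * 2 ^ I.card :=
      Finset.sum_le_sum fun R _ => (Nat.pow_le_pow_left (hA R) _).trans (hC R _)
    _ = _ := (Finset.sum_mul _ _ _).symm

/-- The PDBs in `FO(TI)` have finite expected size. -/
theorem PDB.InFOTI.tsum_card_ne_top [Countable U] {𝓓 : PDB τ U} (h : 𝓓.InFOTI) :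
    ∑' D, 𝓓.prob D * D.card ≠ ∞ := by
  classical
  obtain ⟨σ, 𝓘, V, hTI, -, himg⟩ := h
  obtain ⟨C, hC⟩ := V.exists_card_apply_le
  have h1 : ∀ D, 𝓓.prob D * D.card ≤
      ∑' I, if D = V.apply I then 𝓘.prob I * (C * 2 ^ I.card) else 0 := by
    intro D
    by_cases hD : D ∈ 𝓓.space
    · rw [himg D hD, PDB.Pr, PMF.toOuterMeasure_apply, ← ENNReal.tsum_mul_right]
      refine ENNReal.tsum_le_tsum fun I => ?_
      rw [Set.indicator_apply]
      split_ifs with h2 h3 h3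
      · rw [h3]
        gcongr
        exact_mod_cast hC I
      · exact absurd h2.2.symm h3
      · simp
      · simp
    · rw [(PMF.apply_eq_zero_iff _ _).2 fun h => hD (𝓓.support_subset h), zero_mul]
      exact zero_le
  refine ne_top_of_le_ne_top ?_ (ENNReal.tsum_le_tsum h1)
  rw [ENNReal.tsum_comm]
  simp only [tsum_ite_eq]
  have h2 : ∀ I, 𝓘.prob I * (C * 2 ^ I.card) = C * (𝓘.prob I * 2 ^ I.card) :=
    fun I => by ring
  simp only [h2]
  rw [ENNReal.tsum_mul_left]
  exact ENNReal.mul_ne_top (ENNReal.natCast_ne_top C) hTI.tsum_two_pow_card_ne_top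

end

/-! ### Probabilistic databases with prescribed worlds -/

section

variable {τ : Schema} {U : Type u}

theorem PDB.worlds_eq_support (𝓓 : PDB τ U) : 𝓓.worlds = 𝓓.prob.support := by
  ext D
  simp only [PDB.worlds, Set.mem_ofPred_eq, PMF.apply_pos_iff]
  exact ⟨fun h => h.2, fun h => ⟨𝓓.support_subset h, h⟩⟩

/-- The PDB with a given distribution whose sample space is the set of its worlds. -/
def PDB.ofPMF (μ : PMF (Inst τ U)) : PDB τ U where
  space := μ.support
  countable_space := μ.support_countable
  prob := μ
  support_subset := subset_rfl

theorem PDB.worlds_ofPMF (μ : PMF (Inst τ U)) : (PDB.ofPMF μ).worlds = μ.support :=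
  PDB.worlds_eq_support _

theorem support_map_of_ne_zero {p : PMF ℕ} (hp : ∀ n, p n ≠ 0) {α : Type*} (g : ℕ → α) :
    (p.map g).support = Set.range g := by
  ext a
  simp [PMF.mem_support_iff, hp]

theorem tsum_pmf_map_mul {α β : Type*} (p : PMF α) (g : α → β) (F : β → ℝ≥0∞) :
    ∑' b, p.map g b * F b = ∑' a, p a * F (g a) := by
  classical
  simp only [PMF.map_apply, ← ENNReal.tsum_mul_right]
  rw [ENNReal.tsum_comm]
  refine tsum_congr fun a => ?_
  rw [tsum_eq_single (g a) fun b hb => by simp [hb]]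
  simp

/-- A distribution with full support that decreases fast with respect to given exponents. -/
theorem exists_pmf_le_pow (len : ℕ → ℕ) (hlen : ∀ n, 0 < len n) :
    ∃ p : PMF ℕ, (∀ n, p n ≠ 0) ∧ ∃ s : ℕ → ℝ, (∀ n, 0 ≤ s n) ∧
      (∀ n, (p n).toReal ≤ s n ^ len n) ∧ Summable fun n => len n * s n := by
  have hl : ∀ n, (1 : ℝ) ≤ len n := fun n => by exact_mod_cast hlen n
  let s : ℕ → ℝ := fun n => (1 / 2 : ℝ) ^ (n + 1) / len n
  have hs0 : ∀ n, 0 < s n := fun n => by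
    have := hl n
    positivity
  have hsle : ∀ n, s n ≤ (1 / 2 : ℝ) ^ (n + 1) := fun n => div_le_self (by positivity) (hl n)
  have hs1 : ∀ n, s n ≤ 1 := fun n => (hsle n).trans (pow_le_one₀ (by norm_num) (by norm_num))
  have hgeom : HasSum (fun n : ℕ => (1 / 2 : ℝ) ^ (n + 1)) 1 := by
    simpa [pow_succ'] using hasSum_geometric_two.mul_left (1 / 2 : ℝ)
  let w : ℕ → ℝ := fun n => s n ^ len n
  have hw0 : ∀ n, 0 < w n := fun n => pow_pos (hs0 n) _
  have hwle : ∀ n, w n ≤ (1 / 2 : ℝ) ^ (n + 1) := fun n =>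
    (pow_le_of_le_one (hs0 n).le (hs1 n) (hlen n).ne').trans (hsle n)
  have hws : Summable w := Summable.of_nonneg_of_le (fun n => (hw0 n).le) hwle hgeom.summable
  set W := ∑' n, w n with hW
  have hW0 : 0 < W := hws.tsum_pos (fun n => (hw0 n).le) 0 (hw0 0)
  have hW1 : W ≤ 1 := (hws.tsum_le_tsum hwle hgeom.summable).trans hgeom.tsum_eq.le
  have hp0 : ∀ n, 0 < w n / W := fun n => div_pos (hw0 n) hW0
  have hsum : HasSum (fun n => ENNReal.ofReal (w n / W)) 1 := by
    have h1 : HasSum (fun n => w n / W) 1 := by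
      have h2 := hws.hasSum.div_const W
      rwa [← hW, div_self hW0.ne'] at h2
    rw [← ENNReal.ofReal_one, ← h1.tsum_eq,
      ENNReal.ofReal_tsum_of_nonneg (fun n => (hp0 n).le) h1.summable]
    exact ENNReal.summable.hasSum
  -- Normalizing `w` by `W ≤ 1` preserves the power bound because `W ^ len n ≤ W`, whence `w n / W ≤
  -- (s n / W) ^ len n`.
  refine ⟨⟨_, hsum⟩, fun n => ?_, fun n => s n / W, fun n => (div_pos (hs0 n) hW0).le,
    fun n => ?_, ?_⟩
  · exact (ENNReal.ofReal_pos.2 (hp0 n)).ne'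
  · change (ENNReal.ofReal (w n / W)).toReal ≤ _
    rw [ENNReal.toReal_ofReal (hp0 n).le, div_pow]
    exact div_le_div_of_nonneg_left (hw0 n).le (by positivity)
      (pow_le_of_le_one hW0.le hW1 (hlen n).ne')
  · refine (hgeom.summable.div_const W).congr fun n => ?_
    have := hl n
    simp only [s]
    field_simp

theorem exists_range_eq [Countable U] {𝔻 : Set (Inst τ U)} (h : 𝔻.Nonempty) :
    ∃ g : ℕ → Inst τ U, Set.range g = 𝔻 := by
  obtain ⟨g, hg⟩ := (Set.to_countable 𝔻).exists_eq_range h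
  exact ⟨g, hg.symm⟩

theorem exists_inFOTI_worlds_eq [Countable U] [Infinite U] {𝔻 : Set (Inst τ U)}
    (h : 𝔻.Nonempty) : ∃ 𝓓 : PDB τ U, 𝓓.worlds = 𝔻 ∧ 𝓓.InFOTI := by
  obtain ⟨g, rfl⟩ := exists_range_eq h
  obtain ⟨p, hp, s, hs0, hps, hsum⟩ :=
    -- One fact per cell; the maximum with `1` gives the empty instance a cell carrying nothing.
    exists_pmf_le_pow (fun n => max 1 (g n).card) fun n => by simp
  refine ⟨PDB.ofPMF (p.map g), ?_, ?_⟩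
  · rw [PDB.worlds_ofPMF, support_map_of_ne_zero hp]
  · refine PDB.inFOTI_of_summable _ p g (hp 0) rfl 1 _ (fun n => by simp)
      (fun n j _ => (g n).toList[j]?) (fun n _ f => ?_) s hs0 hps hsum
    rw [← Finset.mem_toList, List.mem_iff_getElem?]
    constructor
    · rintro ⟨j, hj⟩
      have hlt : j < (g n).card := by
        simpa using (List.getElem?_eq_some_iff.1 hj).1
      exact ⟨j, lt_max_of_lt_right hlt, 0, hj⟩
    · rintro ⟨j, -, -, hj⟩
      exact ⟨j, hj⟩

theorem PDB.inFOTI_of_boundedSize [Countable U] [Infinite U] (𝓓 : PDB τ U)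
    (h : BoundedSize 𝓓.worlds) : 𝓓.InFOTI := by
  classical
  obtain ⟨c, hc⟩ := h
  rw [PDB.worlds_eq_support] at hc
  obtain ⟨D₀, hD₀⟩ := 𝓓.prob.support_nonempty
  obtain ⟨enc⟩ := nonempty_encodable (Inst τ U)
  -- The swap gives a world of positive probability the code `0`, as the criterion demands `p 0 ≠
  -- 0`.
  let sw : Equiv.Perm ℕ := Equiv.swap 0 (Encodable.encode D₀)
  let code : Inst τ U → ℕ := fun D => sw (Encodable.encode D)
  let dec : ℕ → Inst τ U := fun n => (Encodable.decode (sw.symm n)).getD ∅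
  have hdec : dec ∘ code = id := by
    funext D
    simp [dec, code]
  have hmap : (𝓓.prob.map code).map dec = 𝓓.prob := by
    rw [PMF.map_comp, hdec, PMF.map_id]
  -- With `c` slots each world fits into a single cell, so `s` may be the distribution itself, whose
  -- sum is finite.
  refine 𝓓.inFOTI_of_summable (𝓓.prob.map code) dec ?_ hmap c (fun _ => 1) (fun _ => one_pos)
    (fun n _ k => (dec n).toList[(k : ℕ)]?) (fun n hn f => ?_)
    (fun n => ((𝓓.prob.map code) n).toReal) (fun _ => ENNReal.toReal_nonneg)
    (fun n => (pow_one _).ge) ?_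
  · rw [← PMF.mem_support_iff, PMF.mem_support_map_iff]
    exact ⟨D₀, hD₀, by simp [code, sw]⟩
  · have hcard : (dec n).card ≤ c := by
      apply hc
      rw [← hmap, PMF.mem_support_map_iff]
      exact ⟨n, hn, rfl⟩
    rw [← Finset.mem_toList, List.mem_iff_getElem?]
    constructor
    · rintro ⟨k, hk⟩
      have hlt : k < (dec n).card := by
        simpa using (List.getElem?_eq_some_iff.1 hk).1
      exact ⟨0, one_pos, ⟨k, hlt.trans_le hcard⟩, hk⟩
    · rintro ⟨-, -, k, hk⟩
      exact ⟨k, hk⟩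
  · simpa using ENNReal.summable_toReal (𝓓.prob.map code).tsum_coe_ne_top

theorem exists_not_inFOTI_worlds_eq [Countable U] {𝔻 : Set (Inst τ U)} (h : UnboundedSize 𝔻) :
    ∃ 𝓓 : PDB τ U, 𝓓.worlds = 𝔻 ∧ ¬ 𝓓.InFOTI := by
  classical
  obtain ⟨g, hg⟩ := exists_range_eq (𝔻 := 𝔻) (by
    obtain ⟨D, hD, -⟩ := h 0
    exact ⟨D, hD⟩)
  obtain ⟨p, hp, -⟩ := exists_pmf_le_pow (fun _ => 1) fun _ => one_pos
  have hlarge : ∀ n, ∃ D ∈ 𝔻, 1 ≤ p n * (D.card : ℝ≥0∞) := by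
    intro n
    obtain ⟨k, hk⟩ := ENNReal.exists_nat_mul_gt (hp n) ENNReal.one_ne_top
    obtain ⟨D, hD, hkD⟩ := h k
    refine ⟨D, hD, hk.le.trans ?_⟩
    rw [mul_comm]
    gcongr
  choose D hD hDp using hlarge
  -- Even indices enumerate all of `𝔻`; each odd index `n` selects a world of size at least `1 / p
  -- n`, contributing at least `1` to the expected size.
  let g' : ℕ → Inst τ U := fun n => if Even n then g (n / 2) else D n
  refine ⟨PDB.ofPMF (p.map g'), ?_, fun hF => hF.tsum_card_ne_top ?_⟩
  · rw [PDB.worlds_ofPMF, support_map_of_ne_zero hp]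
    apply Set.Subset.antisymm
    · rintro _ ⟨n, rfl⟩
      simp only [g']
      split_ifs
      · exact hg ▸ Set.mem_range_self _
      · exact hD n
    · rw [← hg]
      rintro _ ⟨n, rfl⟩
      exact ⟨2 * n, by simp [g']⟩
  · change ∑' D, p.map g' D * (D.card : ℝ≥0∞) = ∞
    rw [tsum_pmf_map_mul p g' fun D => (D.card : ℝ≥0∞)]
    rw [← top_le_iff, ← ENNReal.tsum_const_eq_top_of_ne_zero (α := ℕ) one_ne_zero]
    refine le_trans (ENNReal.tsum_le_tsum fun n => ?_)
      (ENNReal.tsum_comp_le_tsum_of_injective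
        (f := fun n : ℕ => 2 * n + 1) (fun a b hab => by simpa using hab)
        fun n => p n * ((g' n).card : ℝ≥0∞))
    have : ¬ Even (2 * n + 1) := by simp
    simpa only [g', if_neg this] using hDp (2 * n + 1)

end

end ProbDB

theorem mainTheorem7 {U : Type*} [Countable U] [Infinite U] (τ : ProbDB.Schema)
    (𝔻 : Set (ProbDB.Inst τ U)) :
    (ProbDB.BoundedSize 𝔻 → ∀ 𝓓 : ProbDB.PDB τ U, 𝓓.worlds = 𝔻 → 𝓓.InFOTI) ∧
    (ProbDB.UnboundedSize 𝔻 →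
      ∃ 𝓓₁ 𝓓₂ : ProbDB.PDB τ U,
        𝓓₁.InFOTI ∧ ¬ 𝓓₂.InFOTI ∧ 𝓓₁.worlds = 𝔻 ∧ 𝓓₂.worlds = 𝔻) ∧
    (𝔻.Nonempty → ∃ 𝓓 : ProbDB.PDB τ U, 𝓓.worlds = 𝔻 ∧ 𝓓.InFOTI) := by
  refine ⟨?_, ?_, ProbDB.exists_inFOTI_worlds_eq⟩
  · rintro h 𝓓 rfl
    exact 𝓓.inFOTI_of_boundedSize h
  · intro h
    obtain ⟨D, hD, -⟩ := h 0
    obtain ⟨𝓓₁, hw₁, h₁⟩ := ProbDB.exists_inFOTI_worlds_eq ⟨D, hD⟩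
    obtain ⟨𝓓₂, hw₂, h₂⟩ := ProbDB.exists_not_inFOTI_worlds_eq h
    exact ⟨𝓓₁, 𝓓₂, h₁, h₂, hw₁, hw₂⟩
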